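/- **Theorem.** For an $N\times N$ sign matrix $S\in\{\pm1\}^{N\times N}$ let $\operatorname{sign-rank}(S)$ be the minimum rank over $\mathbb{R}$ of a real matrix $M$ with $\operatorname{sign}(M_{i,j})=S_{i,j}$ for all $i,j$. There are a universal constant $c>0$ and a (deterministic) algorithm, running in time polynomial in $N$ (on a random access machine with logarithmic cost), which, given any $N\ge 2$ and any $N\times N$ sign matrix $S$, outputs a natural number $A$ such that $$\operatorname{sign-rank}(S)\;\le\; A\;\le\; c\cdot\frac{N}{\log N}\cdot\operatorname{sign-rank}(S).$$ -/

import Mathlib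

/-- The sign rank of a sign matrix `S` (entries in `ℤˣ = {1, -1}`): the least rank over `ℝ` of a
real matrix `M` with `sign (M i j) = S i j` for all `i`, `j`. As `Real.sign 0 = 0`, such an `M`
has no zero entry. -/
noncomputable def signRank {m n : Type*} [Fintype m] [Fintype n] (S : Matrix m n ℤˣ) : ℕ :=
  sInf {r | ∃ M : Matrix m n ℝ, (∀ i j, Real.sign (M i j) = ((S i j : ℤ) : ℝ)) ∧ M.rank = r}

namespace RAM

/-! A random access machine with the logarithmic cost criterion, programmed by structured
programs. The store has scalar registers and arrays of unbounded length, all holding natural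
numbers; a given program mentions only finitely many registers and arrays. -/

/-- The store of the machine: register `x` holds `reg x`, and cell `i` of array `a` holds
`arr a i`. -/
structure Store where
  reg : ℕ → ℕ
  arr : ℕ → ℕ → ℕ

/-- Arithmetic terms. The argument of `lit` is a constant of the program, that of `reg` the name
of a register, and `get a e` reads the cell of the array `a` whose address is the value of `e`. -/
inductive Term where
  | lit (n : ℕ)
  | reg (x : ℕ)
  | get (a : ℕ) (e : Term)
  | add (e f : Term)
  | sub (e f : Term)
  | mul (e f : Term)

/-- The value of a term. Subtraction is the truncated subtraction of natural numbers. -/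
def Term.val (s : Store) : Term → ℕ
  | lit n => n
  | reg x => s.reg x
  | get a e => s.arr a (e.val s)
  | add e f => e.val s + f.val s
  | sub e f => e.val s - f.val s
  | mul e f => e.val s * f.val s

/-- The logarithmic cost of evaluating a term: every constant, register access, memory access and
arithmetic operation costs one plus the number of binary digits of the number it yields. The
address of a memory access is itself the value of a term, hence charged as well. -/
def Term.cost (s : Store) : Term → ℕ
  | lit n => 1 + Nat.size n
  | reg x => 1 + Nat.size (s.reg x)
  | get a e => e.cost s + (1 + Nat.size (s.arr a (e.val s)))
  | add e f => e.cost s + f.cost s + (1 + Nat.size (e.val s + f.val s))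
  | sub e f => e.cost s + f.cost s + (1 + Nat.size (e.val s - f.val s))
  | mul e f => e.cost s + f.cost s + (1 + Nat.size (e.val s * f.val s))

/-- Programs: no operation, assignment to a register, assignment to the array cell with address
`e`, composition, branching on `e ≠ 0`, and iteration as long as `e ≠ 0`. -/
inductive Prog where
  | skip
  | assign (x : ℕ) (e : Term)
  | put (a : ℕ) (e f : Term)
  | seq (p q : Prog)
  | ite (e : Term) (p q : Prog)
  | loop (e : Term) (p : Prog)

/-- `Exec p s t s'`: started in the store `s`, the program `p` halts after time `t` in the
store `s'`. -/
inductive Exec : Prog → Store → ℕ → Store → Prop where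
  | skip (s : Store) : Exec .skip s 1 s
  | assign (x : ℕ) (e : Term) (s : Store) :
      Exec (.assign x e) s (1 + e.cost s) ⟨Function.update s.reg x (e.val s), s.arr⟩
  | put (a : ℕ) (e f : Term) (s : Store) :
      Exec (.put a e f) s (1 + e.cost s + f.cost s)
        ⟨s.reg, Function.update s.arr a (Function.update (s.arr a) (e.val s) (f.val s))⟩
  | seq {p q : Prog} {s s' s'' : Store} {t t' : ℕ} :
      Exec p s t s' → Exec q s' t' s'' → Exec (.seq p q) s (t + t') s''
  | ite_true {e : Term} {p q : Prog} {s s' : Store} {t : ℕ} :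
      e.val s ≠ 0 → Exec p s t s' → Exec (.ite e p q) s (1 + e.cost s + t) s'
  | ite_false {e : Term} {p q : Prog} {s s' : Store} {t : ℕ} :
      e.val s = 0 → Exec q s t s' → Exec (.ite e p q) s (1 + e.cost s + t) s'
  | loop_true {e : Term} {p : Prog} {s s' s'' : Store} {t t' : ℕ} :
      e.val s ≠ 0 → Exec p s t s' → Exec (.loop e p) s' t' s'' →
        Exec (.loop e p) s (1 + e.cost s + t + t') s''
  | loop_false {e : Term} {p : Prog} {s : Store} :
      e.val s = 0 → Exec (.loop e p) s (1 + e.cost s) s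

/-- Execution is deterministic: running time and final store are determined by the program and
the initial store. -/
theorem Exec.unique {p : Prog} {s s₁ s₂ : Store} {t₁ t₂ : ℕ} (h₁ : Exec p s t₁ s₁)
    (h₂ : Exec p s t₂ s₂) : t₁ = t₂ ∧ s₁ = s₂ := by
  induction h₁ generalizing t₂ s₂ with
  | skip | assign | put => cases h₂; exact ⟨rfl, rfl⟩
  | seq _ _ ih ih' =>
    cases h₂ with
    | seq a b =>
      obtain ⟨rfl, rfl⟩ := ih a
      obtain ⟨rfl, rfl⟩ := ih' b
      exact ⟨rfl, rfl⟩
  | ite_true h _ ih =>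
    cases h₂ with
    | ite_true _ a => obtain ⟨rfl, rfl⟩ := ih a; exact ⟨rfl, rfl⟩
    | ite_false h' _ => exact absurd h' h
  | ite_false h _ ih =>
    cases h₂ with
    | ite_true h' _ => exact absurd h h'
    | ite_false _ a => obtain ⟨rfl, rfl⟩ := ih a; exact ⟨rfl, rfl⟩
  | loop_true h _ _ ih ih' =>
    cases h₂ with
    | loop_true _ a b =>
      obtain ⟨rfl, rfl⟩ := ih a
      obtain ⟨rfl, rfl⟩ := ih' b
      exact ⟨rfl, rfl⟩
    | loop_false h' => exact absurd h' h
  | loop_false h =>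
    cases h₂ with
    | loop_true h' _ _ => exact absurd h h'
    | loop_false _ => exact ⟨rfl, rfl⟩

/-- The initial store on input an `N × N` sign matrix `S`: register `0` holds `N`, array `0` holds
the entries of `S` row by row (`1` for the entry `1`, and `0` for the entry `-1`), and
everything else is `0`. -/
def input {N : ℕ} (S : Matrix (Fin N) (Fin N) ℤˣ) : Store where
  reg x := if x = 0 then N else 0
  arr a k :=
    if h : a = 0 ∧ k < N * N then
      if S (Fin.divNat ⟨k, h.2⟩) (Fin.modNat ⟨k, h.2⟩) = 1 then 1 else 0
    else 0

/-- `Outputs p S t A`: on input the sign matrix `S`, the program `p` halts after time `t` with the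
number `A` in register `0`. -/
def Outputs {N : ℕ} (p : Prog) (S : Matrix (Fin N) (Fin N) ℤˣ) (t A : ℕ) : Prop :=
  ∃ s : Store, Exec p (input S) t s ∧ s.reg 0 = A

end RAM

/-! Let d be the sign rank. If the rows can be listed so that every column changes sign at most K
times along the list, then each column is the sign pattern of a polynomial of degree at most K at
the row positions, and the factorization "Vandermonde times coefficients" gives d ≤ K + 1
(`signRank_le_of_changes`). So it suffices to find efficiently a list with K = O(d N / log N).

Such a list is a walk around a spanning tree on the rows, in which a column changes at most twice
for each tree edge whose ends it separates. The tree is built greedily with multiplicative weights: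
join two active rows at the least weighted distance, retire one of them, and double the weight of
every column in which they differ. A set of columns shattered by the rows has at most d elements
(`card_le_signRank_of_shattered`), so a packing argument of Haussler type yields, among M active
rows, two at relative weighted distance at most 10 d / log M (`exists_close_pair`). One step
therefore multiplies the total weight by at most 1 + 10 d / log M. A column doubled κ times has
weight 2 ^ κ, at most the final total, whence κ ≤ O(log N + d ∑ 1 / log m) = O(d N / log N).

The number d enters only the analysis: the program outputs one plus twice the largest κ, which the
tree shows to be at least d and the weights show to be O(d N / log N). The invariant `GreedyState`
carries both halves. Since κ ≤ N, all stored numbers have O(N) digits, and a Hoare calculus with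
time bounds gives polynomial time. -/

/-! ### Sign changes along a list, and polynomials -/

/-- The number of adjacent positions of a list at which the entry changes. -/
def List.changes {α : Type*} [DecidableEq α] : List α → ℕ
  | [] => 0
  | [_] => 0
  | a :: b :: l => (if a = b then 0 else 1) + List.changes (b :: l)

/-- Only the junction behind `v` is affected. If `u = v`, nothing is added; otherwise the two new
junctions around `u` add at most 2. -/
theorem List.changes_insert_le {α : Type*} [DecidableEq α] (v u : α) (l₂ : List α) :
    ∀ l₁ : List α, List.changes (l₁ ++ v :: u :: l₂) ≤
      List.changes (l₁ ++ v :: l₂) + 2 * (if u = v then 0 else 1)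
  | [] => by
    cases l₂ with
    | nil => simp only [List.nil_append, List.changes]; grind
    | cons c l => simp only [List.nil_append, List.changes]; grind
  | [a] => by
    have := List.changes_insert_le v u l₂ []
    simp only [List.nil_append, List.cons_append, List.changes] at this ⊢
    omega
  | a :: b :: l => by
    have := List.changes_insert_le v u l₂ (b :: l)
    simp only [List.cons_append, List.changes] at this ⊢
    omega

/-- A sequence of signs with `k` changes is the sign sequence of a polynomial of degree at
most `k` at the points `0, 1, 2, …`. -/
theorem List.exists_polynomial_sign (l : List ℤˣ) :
    ∃ p : Polynomial ℝ, p.natDegree ≤ l.changes ∧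
      (∀ (i : ℕ) (h : i < l.length), 0 < ((l[i] : ℤ) : ℝ) * p.eval (i : ℝ)) ∧
      ∀ b ∈ l.head?, ∀ x : ℝ, x ≤ 0 → 0 < ((b : ℤ) : ℝ) * p.eval x := by
  -- The third clause strengthens the induction: prepending an entry shifts the polynomial by one,
  -- so the new point `0` evaluates the old polynomial at `-1`, where it must still have the sign of
  -- the old head.
  induction l with
  | nil => exact ⟨0, by simp, by simp, by simp⟩
  | cons a l ih =>
    have hsq : ∀ u : ℤˣ, ((u : ℤ) : ℝ) * ((u : ℤ) : ℝ) = 1 := by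
      intro u; rcases Int.units_eq_one_or u with rfl | rfl <;> simp
    cases l with
    | nil =>
      refine ⟨Polynomial.C ((a : ℤ) : ℝ), by simp, ?_, ?_⟩
      · intro i h
        have : i = 0 := by simpa using h
        subst this
        simp [hsq]
      · intro b h x _
        obtain rfl : a = b := by simpa using h
        simp [hsq]
    | cons b l =>
      obtain ⟨p, hdeg, hp, hp0⟩ := ih
      have hcomp : (p.comp (Polynomial.X - Polynomial.C 1)).natDegree ≤ p.natDegree := by
        refine (Polynomial.natDegree_comp_le).trans ?_
        rw [Polynomial.natDegree_X_sub_C, mul_one]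
      by_cases hab : a = b
      · subst hab
        refine ⟨p.comp (Polynomial.X - Polynomial.C 1), ?_, ?_, ?_⟩
        · simp only [List.changes, if_true]; omega
        · rintro (_ | i) h
          · simpa using hp0 _ rfl (-1) (by norm_num)
          · simpa using hp i (by simpa using h)
        · intro c h x hx
          obtain rfl : a = c := by simpa using h
          simpa using hp0 _ rfl (x - 1) (by linarith)
      · have hneg : ((a : ℤ) : ℝ) = - ((b : ℤ) : ℝ) := by
          rcases Int.units_eq_one_or a with rfl | rfl <;>
            rcases Int.units_eq_one_or b with rfl | rfl <;> simp_all
        -- The factor 2X - 1 has its root between the new point 0 and the point 1, so it flips the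
        -- sign at all x ≤ 0 and at none of the old points.
        refine ⟨p.comp (Polynomial.X - Polynomial.C 1) *
          (Polynomial.C 2 * Polynomial.X - Polynomial.C 1), ?_, ?_, ?_⟩
        · have h1 : (Polynomial.C (2 : ℝ) * Polynomial.X - Polynomial.C 1).natDegree ≤ 1 := by
            compute_degree
          have h2 := Polynomial.natDegree_mul_le (p := p.comp (Polynomial.X - Polynomial.C 1))
            (q := Polynomial.C (2 : ℝ) * Polynomial.X - Polynomial.C 1)
          simp only [List.changes, hab, if_false]; omega
        · rintro (_ | i) h
          · have := hp0 _ rfl (-1) (by norm_num)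
            simp [hneg]
            linarith
          · have := hp i (by simpa using h)
            simp
            rw [← mul_assoc]
            refine mul_pos this ?_
            have : (0 : ℝ) ≤ i := Nat.cast_nonneg i
            linarith
        · intro c h x hx
          obtain rfl : a = c := by simpa using h
          have := hp0 _ rfl (x - 1) (by linarith)
          simp [hneg]
          rw [← mul_assoc]
          exact mul_neg_of_pos_of_neg this (by linarith)

/-! ### Upper and lower bounds for the sign rank -/

theorem Real.sign_eq_of_mul_pos (u : ℤˣ) (x : ℝ) (h : 0 < ((u : ℤ) : ℝ) * x) :
    Real.sign x = ((u : ℤ) : ℝ) := by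
  rcases Int.units_eq_one_or u with rfl | rfl
  · simp at h; simp [Real.sign_of_pos h]
  · simp at h; simp [Real.sign_of_neg h]

theorem exists_rank_eq_signRank {m n : Type*} [Fintype m] [Fintype n] (S : Matrix m n ℤˣ) :
    ∃ M : Matrix m n ℝ, (∀ i j, Real.sign (M i j) = ((S i j : ℤ) : ℝ)) ∧ M.rank = signRank S := by
  refine Nat.sInf_mem (s := {r | ∃ M : Matrix m n ℝ,
    (∀ i j, Real.sign (M i j) = ((S i j : ℤ) : ℝ)) ∧ M.rank = r}) ?_
  refine ⟨_, fun i j => ((S i j : ℤ) : ℝ), fun i j => ?_, rfl⟩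
  rcases Int.units_eq_one_or (S i j) with h | h
  · simp [h]
  · simp [h, Real.sign_of_neg]

theorem signRank_le_of_sign {m n : Type*} [Fintype m] [Fintype n] {S : Matrix m n ℤˣ}
    (M : Matrix m n ℝ) (h : ∀ i j, Real.sign (M i j) = ((S i j : ℤ) : ℝ)) :
    signRank S ≤ M.rank :=
  Nat.sInf_le ⟨M, h, rfl⟩

theorem signRank_pos {m n : Type*} [Fintype m] [Fintype n] (S : Matrix m n ℤˣ) (i : m) (j : n) :
    1 ≤ signRank S := by
  obtain ⟨M, hM, hr⟩ := exists_rank_eq_signRank S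
  by_contra hlt
  have h0 : M.rank = 0 := by omega
  have h0' : M.mulVecLin = 0 := by
    rw [← LinearMap.range_eq_bot]
    exact Submodule.finrank_eq_zero.1 h0
  have h00 : M i j = 0 := by
    classical
    have := congrFun (LinearMap.congr_fun h0' (Pi.single j 1)) i
    simpa using this
  have h := hM i j
  rw [h00] at h
  rcases Int.units_eq_one_or (S i j) with h' | h' <;> simp [h'] at h

/-- If the rows can be arranged in a list along which every column changes its sign at most `K`
times, then the sign rank is at most `K + 1`. -/
theorem signRank_le_of_changes {m n : Type*} [Fintype m] [Fintype n]
    (S : Matrix m n ℤˣ) (L : List m) (hL : ∀ i, i ∈ L) (K : ℕ)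
    (hK : ∀ j, (L.map fun i => S i j).changes ≤ K) : signRank S ≤ K + 1 := by
  choose pos hpos hposi using fun i => List.mem_iff_getElem.1 (hL i)
  choose p hdeg hp _ using fun j => List.exists_polynomial_sign (L.map fun i => S i j)
  -- Vandermonde matrix of the positions times coefficient matrix: the inner dimension K + 1 bounds
  -- the rank.
  let V : Matrix m (Fin (K + 1)) ℝ := fun i t => (pos i : ℝ) ^ (t : ℕ)
  let C : Matrix (Fin (K + 1)) n ℝ := fun t j => (p j).coeff t
  have hVC : ∀ i j, (V * C) i j = (p j).eval (pos i : ℝ) := by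
    intro i j
    rw [Matrix.mul_apply, Polynomial.eval_eq_sum_range' (n := K + 1)
      (Nat.lt_succ_of_le ((hdeg j).trans (hK j))), Finset.sum_range]
    exact Finset.sum_congr rfl fun t _ => mul_comm _ _
  refine (signRank_le_of_sign (V * C) fun i j => ?_).trans ?_
  · rw [hVC]
    apply Real.sign_eq_of_mul_pos
    have := hp j (pos i) (by simpa using hpos i)
    simpa [hposi] using this
  · refine (Matrix.rank_mul_le_left V C).trans ?_
    simpa using Matrix.rank_le_card_width V

/-- A set of columns on which the rows show all sign patterns has at most `signRank S`
elements. -/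
theorem card_le_signRank_of_shattered {m n : Type*} [Fintype m] [Fintype n]
    (S : Matrix m n ℤˣ) (s : Finset n)
    (hs : ∀ t ⊆ s, ∃ i, ∀ j ∈ s, (S i j = 1 ↔ j ∈ t)) : s.card ≤ signRank S := by
  classical
  obtain ⟨M, hM, hr⟩ := exists_rank_eq_signRank S
  have hli : LinearIndependent ℝ (fun j : s => M.col (j : n)) := by
    rw [Fintype.linearIndependent_iff]
    intro g hg
    by_contra! hne
    obtain ⟨j₀, hj₀⟩ := hne
    -- In a linear relation `g` among the columns, choose the row whose signs on `s` agree with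
    -- those of `g`: all its nonzero terms are positive, so they cannot sum to zero.
    obtain ⟨i, hi⟩ := hs (s.filter fun j => ∃ h : j ∈ s, 0 < g ⟨j, h⟩) (Finset.filter_subset _ _)
    have hz := congrFun hg i
    simp only [Finset.sum_apply, Pi.smul_apply, smul_eq_mul, Pi.zero_apply, Matrix.col_apply] at hz
    have hsg : ∀ j : s, g j ≠ 0 → 0 < g j * M i j := by
      intro j hj
      have hij := hi j j.2
      have hMij := hM i j
      rcases lt_or_gt_of_ne hj with hlt | hgt
      · have : S i j ≠ 1 := by
          rw [Ne, hij]
          simp [hlt.le]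
        have h1 : S i j = -1 := (Int.units_eq_one_or _).resolve_left this
        rw [h1] at hMij
        have : M i j < 0 := by
          rcases lt_trichotomy (M i j) 0 with h | h | h
          · exact h
          · rw [h] at hMij; simp at hMij
          · rw [Real.sign_of_pos h] at hMij; norm_num at hMij
        exact mul_pos_of_neg_of_neg hlt this
      · have : S i j = 1 := by
          rw [hij]
          simp [hgt]
        rw [this] at hMij
        have : 0 < M i j := by
          rcases lt_trichotomy (M i j) 0 with h | h | h
          · rw [Real.sign_of_neg h] at hMij; norm_num at hMij
          · rw [h] at hMij; simp at hMij
          · exact h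
        exact mul_pos hgt this
    have : 0 < ∑ j : s, g j * M i j := by
      refine Finset.sum_pos' (fun j _ => ?_) ⟨j₀, Finset.mem_univ _, hsg j₀ hj₀⟩
      by_cases h : g j = 0
      · simp [h]
      · exact (hsg j h).le
    exact this.ne' hz
  rw [← hr, Matrix.rank_eq_finrank_span_cols]
  have h1 := finrank_span_eq_card hli
  rw [Fintype.card_coe] at h1
  rw [← h1]
  refine Submodule.finrank_mono (Submodule.span_mono ?_)
  rintro _ ⟨j, rfl⟩
  exact ⟨j, rfl⟩

/-! ### Packing: many rows contain a close pair -/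

/-- Greedy choice of coordinates: if every object in `Q` is hit by at least a fraction `δ` of the
total weight of the coordinates, then `k` coordinates miss at most a fraction `(1 - δ) ^ k`
of `Q`. -/
theorem exists_finset_card_missed_le {ι π : Type*} [Fintype ι] [DecidableEq ι] (w : ι → ℝ)
    (hw : ∀ j, 0 ≤ w j) (hW : 0 < ∑ j, w j) (Q : Finset π) (hit : π → ι → Prop) [∀ q j, Decidable (hit q j)]
    (δ : ℝ) (hδ : δ ≤ 1)
    (h : ∀ q ∈ Q, δ * ∑ j, w j ≤ ∑ j, if hit q j then w j else 0) (k : ℕ) :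
    ∃ T : Finset ι, T.card ≤ k ∧
      ((Q.filter fun q => ∀ j ∈ T, ¬ hit q j).card : ℝ) ≤ (1 - δ) ^ k * Q.card := by
  induction k with
  | zero => exact ⟨∅, by simp, by simp⟩
  | succ k ih =>
    obtain ⟨T, hT, hcard⟩ := ih
    set Q' := Q.filter fun q => ∀ j ∈ T, ¬ hit q j with hQ'
    -- Double counting: on weighted average over the coordinates, a fraction δ of the remaining
    -- objects is hit, so some coordinate does at least that well.
    obtain ⟨j, hj⟩ : ∃ j, δ * Q'.card ≤ ((Q'.filter fun q => hit q j).card : ℝ) := by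
      by_contra! hlt
      have h1 : ∑ j, w j * ((Q'.filter fun q => hit q j).card : ℝ) <
          ∑ j, w j * (δ * Q'.card) := by
        obtain ⟨j₀, _, hj₀⟩ := Finset.exists_lt_of_sum_lt (s := Finset.univ) (f := fun _ => (0 : ℝ))
          (g := w) (by simpa using hW)
        exact Finset.sum_lt_sum (fun j _ => mul_le_mul_of_nonneg_left (hlt j).le (hw j))
          ⟨j₀, Finset.mem_univ _, mul_lt_mul_of_pos_left (hlt j₀) hj₀⟩
      have h2 : ∑ j, w j * ((Q'.filter fun q => hit q j).card : ℝ) =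
          ∑ q ∈ Q', ∑ j, if hit q j then w j else 0 := by
        rw [Finset.sum_comm]
        refine Finset.sum_congr rfl fun j _ => ?_
        rw [← Finset.sum_filter, Finset.sum_const, nsmul_eq_mul, mul_comm]
      have h3 : ∑ q ∈ Q', δ * ∑ j, w j ≤ ∑ q ∈ Q', ∑ j, if hit q j then w j else 0 :=
        Finset.sum_le_sum fun q hq => h q (Finset.mem_filter.1 hq).1
      rw [Finset.sum_const, nsmul_eq_mul] at h3
      rw [h2, ← Finset.sum_mul] at h1
      linarith
    refine ⟨insert j T, (Finset.card_insert_le _ _).trans (by omega), ?_⟩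
    have heq : (Q.filter fun q => ∀ i ∈ insert j T, ¬ hit q i) = Q'.filter fun q => ¬ hit q j := by
      ext q
      simp only [hQ', Finset.mem_filter, Finset.mem_insert, forall_eq_or_imp]
      tauto
    have hsplit := Finset.card_filter_add_card_filter_not (s := Q') (fun q => hit q j)
    have hsplit' : ((Q'.filter fun q => hit q j).card : ℝ) +
      ((Q'.filter fun q => ¬ hit q j).card : ℝ) = Q'.card := by exact_mod_cast hsplit
    rw [heq]
    calc ((Q'.filter fun q => ¬ hit q j).card : ℝ)
          ≤ (1 - δ) * Q'.card := by linarith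
      _ ≤ (1 - δ) * ((1 - δ) ^ k * Q.card) := mul_le_mul_of_nonneg_left hcard (by linarith)
      _ = (1 - δ) ^ (k + 1) * Q.card := by ring

/-- A generating function form of the Sauer–Shelah bound. -/
theorem Finset.card_mul_pow_le_of_shatters {ι : Type*} [DecidableEq ι] (𝒜 : Finset (Finset ι))
    (T : Finset ι) (hT : ∀ s ∈ 𝒜, s ⊆ T) (d : ℕ) (hd : ∀ s, 𝒜.Shatters s → s.card ≤ d)
    (y : ℝ) (hy : 0 ≤ y) (hy1 : y ≤ 1) : (𝒜.card : ℝ) * y ^ d ≤ (1 + y) ^ T.card := by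
  have hsub : 𝒜.shatterer ⊆ T.powerset := by
    intro s hs
    rw [Finset.mem_shatterer] at hs
    obtain ⟨u, hu, hsu⟩ := hs.exists_superset
    exact Finset.mem_powerset.2 (hsu.trans (hT u hu))
  -- A family shatters at least as many sets as it has members. Each shattered set has size at most
  -- d, so y ^ d is at most its term in the binomial expansion over subsets of `T`.
  calc (𝒜.card : ℝ) * y ^ d ≤ (𝒜.shatterer.card : ℝ) * y ^ d := by
        exact mul_le_mul_of_nonneg_right (by exact_mod_cast 𝒜.card_le_card_shatterer)
          (pow_nonneg hy _)
    _ = ∑ _s ∈ 𝒜.shatterer, y ^ d := by rw [Finset.sum_const, nsmul_eq_mul]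
    _ ≤ ∑ s ∈ 𝒜.shatterer, y ^ s.card :=
        Finset.sum_le_sum fun s hs =>
          pow_le_pow_of_le_one hy hy1 (hd s (Finset.mem_shatterer.1 hs))
    _ ≤ ∑ s ∈ T.powerset, y ^ s.card :=
        Finset.sum_le_sum_of_subset_of_nonneg hsub fun s _ _ => pow_nonneg hy _
    _ = (1 + y) ^ T.card := by
        have := Finset.sum_pow_mul_eq_add_pow y (1 : ℝ) T
        simp only [one_pow, mul_one] at this
        rw [this, add_comm]

/-- Packing: a family of rows which are pairwise at relative weighted distance at least `δ` obeys
the Sauer–Shelah bound for the number `k` of columns that separate it. -/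
theorem card_mul_pow_le_of_separated {m n : Type*} [Fintype m] [Fintype n]
    (S : Matrix m n ℤˣ) {M : ℕ} (hM : 0 < M) (f : ℕ → m) (w : n → ℝ) (hw : ∀ j, 0 ≤ w j)
    (hW : 0 < ∑ j, w j) (δ : ℝ) (hδ1 : δ ≤ 1)
    (h : ∀ a b, a < b → b < M →
      δ * ∑ j, w j ≤ ∑ j, if S (f a) j ≠ S (f b) j then w j else 0)
    (k : ℕ) (hk : (1 - δ) ^ k * M ^ 2 ≤ 1) (y : ℝ) (hy : 0 ≤ y) (hy1 : y ≤ 1) :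
    (M : ℝ) * y ^ signRank S ≤ (1 + y) ^ k := by
  classical
  set Q := ((Finset.range M) ×ˢ (Finset.range M)).filter fun q : ℕ × ℕ => q.1 < q.2 with hQ
  obtain ⟨T, hT, hmiss⟩ := exists_finset_card_missed_le w hw hW Q
    (fun q j => S (f q.1) j ≠ S (f q.2) j) δ hδ1 (by
      rintro ⟨a, b⟩ hab
      simp only [hQ, Finset.mem_filter, Finset.mem_product, Finset.mem_range] at hab
      exact h a b hab.2 hab.1.2) k
  -- Strictness matters: together with `hk` it makes the number of pairs not separated by `T` less
  -- than 1, hence 0.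
  have hQlt : (Q.card : ℝ) < (M : ℝ) ^ 2 := by
    have : Q.card < ((Finset.range M) ×ˢ (Finset.range M)).card := by
      refine Finset.card_lt_card (Finset.filter_ssubset.2 ⟨(0, 0), ?_, by simp⟩)
      simpa using hM
    rw [Finset.card_product, Finset.card_range, ← pow_two] at this
    exact_mod_cast this
  have hsep : ∀ a b, a < b → b < M → ∃ j ∈ T, S (f a) j ≠ S (f b) j := by
    intro a b hab hb
    by_contra! hno
    have h1 : 1 ≤ (Q.filter fun q : ℕ × ℕ => ∀ j ∈ T, ¬ S (f q.1) j ≠ S (f q.2) j).card := by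
      refine Finset.card_pos.2 ⟨(a, b), ?_⟩
      simp only [hQ, Finset.mem_filter, Finset.mem_product, Finset.mem_range]
      exact ⟨⟨⟨hab.trans hb, hb⟩, hab⟩, fun j hj => not_not.2 (hno j hj)⟩
    have h2 : (1 : ℝ) ≤ (1 - δ) ^ k * Q.card := le_trans (by exact_mod_cast h1) hmiss
    have h0 : 0 ≤ (1 - δ) ^ k := pow_nonneg (by linarith) _
    rcases h0.eq_or_lt with h0 | h0
    · rw [← h0] at h2; norm_num at h2
    · nlinarith
  let tr : ℕ → Finset n := fun a => T.filter fun j => S (f a) j = 1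
  have htr : ∀ a b, a < b → b < M → tr a ≠ tr b := by
    intro a b hab hb heq
    obtain ⟨j, hj, hne⟩ := hsep a b hab hb
    have : (S (f a) j = 1 ↔ S (f b) j = 1) := by
      have := Finset.ext_iff.1 heq j
      simpa [tr, hj] using this
    rcases Int.units_eq_one_or (S (f a) j) with h1 | h1 <;>
      rcases Int.units_eq_one_or (S (f b) j) with h2 | h2 <;> simp_all
  have hcard : ((Finset.range M).image tr).card = M := by
    rw [Finset.card_image_of_injOn, Finset.card_range]
    intro a ha b hb heq
    simp only [Finset.coe_range, Set.mem_Iio] at ha hb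
    rcases lt_trichotomy a b with hlt | rfl | hlt
    · exact absurd heq (htr a b hlt hb)
    · rfl
    · exact absurd heq.symm (htr b a hlt ha)
  -- The traces of the rows on `T` are distinct, and a set shattered by them lies in `T` and is
  -- shattered by the rows, so its size is at most the sign rank.
  have key := Finset.card_mul_pow_le_of_shatters ((Finset.range M).image tr) T (by
      intro s hs
      obtain ⟨a, _, rfl⟩ := Finset.mem_image.1 hs
      exact Finset.filter_subset _ _) (signRank S) (by
      intro s hs
      refine card_le_signRank_of_shattered S s fun t ht => ?_
      obtain ⟨v, hv, hvs⟩ := hs.exists_superset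
      obtain ⟨v', hv', rfl⟩ := Finset.mem_image.1 hv
      have hsT : s ⊆ T := hvs.trans (Finset.filter_subset _ _)
      obtain ⟨u, hu, hut⟩ := hs ht
      obtain ⟨a, _, rfl⟩ := Finset.mem_image.1 hu
      refine ⟨f a, fun j hj => ?_⟩
      rw [← hut]
      simp [tr, hj, hsT hj]) y hy hy1
  rw [hcard] at key
  exact key.trans (pow_le_pow_right₀ (by linarith) hT)

/-- Among `M` rows of a matrix of sign rank `d` two are at relative weighted distance at
most `10 d / log M`. -/
theorem exists_close_pair {m n : Type*} [Fintype m] [Fintype n]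
    (S : Matrix m n ℤˣ) {M : ℕ} (hM : 2 ≤ M) (f : ℕ → m) (w : n → ℝ) (hw : ∀ j, 0 ≤ w j)
    (hW : 0 < ∑ j, w j) (hd : 1 ≤ signRank S) :
    ∃ a b, a < b ∧ b < M ∧ (∑ j, if S (f a) j ≠ S (f b) j then w j else 0) ≤
      10 * signRank S / Real.log M * ∑ j, w j := by
  set d : ℝ := (signRank S : ℝ) with hddef
  have hd1 : (1 : ℝ) ≤ d := by rw [hddef]; exact_mod_cast hd
  have hMR : (2 : ℝ) ≤ M := by exact_mod_cast hM
  have hlog : 0 < Real.log M := Real.log_pos (by linarith)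
  by_contra! hfar
  -- In the parameter x = log M / d the claimed distance is δ = 10 / x. The packing bound is applied
  -- with k ≈ 2 log M / δ, enough to separate all pairs, and y = 1 / x ^ 2.
  set x : ℝ := Real.log M / d with hx
  have hdx : d * x = Real.log M := by rw [hx]; field_simp
  have hδ : 10 * d / Real.log M = 10 / x := by rw [hx]; field_simp
  rw [hδ] at hfar
  have hxpos : 0 < x := by rw [hx]; positivity
  -- A distance never exceeds the total weight, so all pairs being farther than δ forces δ < 1.
  have hx10 : 10 < x := by
    have h1 := hfar 0 1 (by omega) (by omega)
    have h2 : (∑ j, if S (f 0) j ≠ S (f 1) j then w j else 0) ≤ ∑ j, w j :=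
      Finset.sum_le_sum fun j _ => by split_ifs; exacts [le_rfl, hw j]
    have h3 : 10 / x * ∑ j, w j < 1 * ∑ j, w j := by linarith
    have h4 := lt_of_mul_lt_mul_right h3 hW.le
    rwa [div_lt_one hxpos] at h4
  have hδ1 : 10 / x ≤ 1 := by rw [div_le_one hxpos]; exact hx10.le
  set k := ⌈2 * Real.log M * x / 10⌉₊ with hk
  have hk1 : 2 * Real.log M * x / 10 ≤ k := Nat.le_ceil _
  have hk2 : (k : ℝ) < 2 * Real.log M * x / 10 + 1 := Nat.ceil_lt_add_one (by positivity)
  have hkey := card_mul_pow_le_of_separated S (by omega) f w hw hW (10 / x) hδ1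
    (fun a b hab hb => (hfar a b hab hb).le) k (by
      have h1 : (1 - 10 / x) ^ k ≤ Real.exp (-(2 * Real.log M)) := by
        calc (1 - 10 / x) ^ k ≤ (Real.exp (-(10 / x))) ^ k :=
              pow_le_pow_left₀ (by linarith) (Real.one_sub_le_exp_neg _) _
          _ = Real.exp (k * (-(10 / x))) := (Real.exp_nat_mul _ _).symm
          _ ≤ Real.exp (-(2 * Real.log M)) := by
              rw [Real.exp_le_exp]
              have : 2 * Real.log M = 2 * Real.log M * x / 10 * (10 / x) := by field_simp
              rw [this]
              have h10 : 0 < 10 / x := by positivity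
              nlinarith
      have h2 : Real.exp (-(2 * Real.log M)) * (M : ℝ) ^ 2 = 1 := by
        have : (M : ℝ) ^ 2 = Real.exp (2 * Real.log M) := by
          rw [two_mul, Real.exp_add, Real.exp_log (by linarith), pow_two]
        rw [this, ← Real.exp_add]; simp
      exact (mul_le_mul_of_nonneg_right h1 (by positivity)).trans h2.le) (1 / x ^ 2) (by positivity)
      (by rw [div_le_one (by positivity)]; nlinarith)
  have hlogs : Real.log M - d * (2 * Real.log x) ≤ k / x ^ 2 := by
    have h1 := Real.log_le_log (by positivity) hkey
    rw [Real.log_mul (by linarith) (by positivity), Real.log_pow, Real.log_pow, one_div,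
      Real.log_inv, Real.log_pow] at h1
    have h2 : Real.log (1 + (x ^ 2)⁻¹) ≤ (x ^ 2)⁻¹ := by
      have := Real.log_le_sub_one_of_pos (x := 1 + (x ^ 2)⁻¹) (by positivity)
      linarith
    have h3 : (k : ℝ) * Real.log (1 + (x ^ 2)⁻¹) ≤ k * (x ^ 2)⁻¹ :=
      mul_le_mul_of_nonneg_left h2 (Nat.cast_nonneg _)
    rw [div_eq_mul_inv]
    push_cast at h1
    linarith
  have hkx : (k : ℝ) / x ^ 2 ≤ 2 * d / 10 + 1 := by
    rw [div_le_iff₀ (by positivity)]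
    have : 2 * Real.log M * x / 10 = 2 * d / 10 * x ^ 2 := by rw [← hdx]; ring
    nlinarith
  -- The tangent of the logarithm at 4. It turns `hlogs` and `hkx` into d (x / 2 - 2) ≤ d / 5 + 1,
  -- which fails for x > 10 and d ≥ 1.
  have hlx : Real.log x ≤ x / 4 + 1 := by
    have h1 : Real.log (x / 4) ≤ x / 4 - 1 := Real.log_le_sub_one_of_pos (by positivity)
    rw [Real.log_div (by positivity) (by norm_num)] at h1
    have h2 : Real.log 4 ≤ 2 := by
      have : (4 : ℝ) = 2 ^ 2 := by norm_num
      rw [this, Real.log_pow]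
      have := Real.log_two_lt_d9
      push_cast
      linarith
    linarith
  rw [← hdx] at hlogs
  nlinarith [mul_le_mul_of_nonneg_left hlx (by linarith : 0 ≤ d)]

/-! ### The sum of inverse logarithms -/

theorem Real.log_le_two_mul_sqrt {x : ℝ} (hx : 0 < x) : Real.log x ≤ 2 * √x := by
  have h1 := Real.log_le_sub_one_of_pos (Real.sqrt_pos.2 hx)
  rw [Real.log_sqrt hx.le] at h1
  linarith

/-- Split at √N: the at most √N = O(N / log N) small m contribute at most 1 / log 2 ≤ 3 / 2 each,
and for the others log m ≥ (log N) / 2. -/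
theorem sum_inv_log_le {N : ℕ} (hN : 2 ≤ N) :
    ∑ m ∈ Finset.Ioc 1 N, (Real.log m)⁻¹ ≤ 5 * (N / Real.log N) := by
  have hNR : (2 : ℝ) ≤ N := by exact_mod_cast hN
  have hlog : 0 < Real.log N := Real.log_pos (by linarith)
  have hl2 := Real.log_two_gt_d9
  have hterm : ∀ m ∈ Finset.Ioc 1 N,
      (Real.log m)⁻¹ ≤ (if m ≤ Nat.sqrt N then (3 / 2 : ℝ) else 0) + 2 / Real.log N := by
    intro m hm
    rw [Finset.mem_Ioc] at hm
    have hm2 : (2 : ℝ) ≤ m := by exact_mod_cast hm.1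
    split_ifs with h
    · have : (Real.log m)⁻¹ ≤ 3 / 2 := by
        rw [inv_le_comm₀ (Real.log_pos (by linarith)) (by norm_num)]
        have := Real.log_le_log (by norm_num) hm2
        norm_num; linarith
      have : 0 < 2 / Real.log N := by positivity
      linarith
    · have h1 : N < m * m := Nat.sqrt_lt.1 (not_le.1 h)
      have h2 : (N : ℝ) ≤ m * m := by exact_mod_cast h1.le
      have h3 := Real.log_le_log (by linarith) h2
      rw [Real.log_mul (by linarith) (by linarith)] at h3
      rw [zero_add, inv_le_comm₀ (Real.log_pos (by linarith)) (by positivity), inv_div]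
      linarith
  have hcount : ((Finset.Ioc 1 N).filter (· ≤ Nat.sqrt N)).card ≤ Nat.sqrt N := by
    calc _ ≤ (Finset.Ioc 0 (Nat.sqrt N)).card := Finset.card_le_card (by
            intro m hm
            simp only [Finset.mem_filter, Finset.mem_Ioc] at hm ⊢
            omega)
      _ = _ := by simp
  have hs1 : (Nat.sqrt N : ℝ) ≤ √N := Real.nat_sqrt_le_real_sqrt
  have hs2 : √N ≤ 2 * (N / Real.log N) := by
    rw [← mul_div_assoc, le_div_iff₀ hlog]
    have := Real.log_le_two_mul_sqrt (x := (N : ℝ)) (by linarith)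
    have h3 := Real.mul_self_sqrt (x := (N : ℝ)) (by linarith)
    nlinarith [Real.sqrt_nonneg (N : ℝ)]
  have hcount' : (((Finset.Ioc 1 N).filter (· ≤ Nat.sqrt N)).card : ℝ) ≤ Nat.sqrt N := by
    exact_mod_cast hcount
  calc ∑ m ∈ Finset.Ioc 1 N, (Real.log m)⁻¹
      ≤ ∑ m ∈ Finset.Ioc 1 N,
          ((if m ≤ Nat.sqrt N then (3 / 2 : ℝ) else 0) + 2 / Real.log N) :=
        Finset.sum_le_sum hterm
    _ = ((Finset.Ioc 1 N).filter (· ≤ Nat.sqrt N)).card * (3 / 2) +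
          (N - 1 : ℕ) * (2 / Real.log N) := by
        rw [Finset.sum_add_distrib, ← Finset.sum_filter, Finset.sum_const, Finset.sum_const,
          nsmul_eq_mul, nsmul_eq_mul, Nat.card_Ioc]
    _ ≤ (2 * (N / Real.log N)) * (3 / 2) + N * (2 / Real.log N) := by
        gcongr
        · linarith
        · omega
    _ = 5 * (N / Real.log N) := by ring

/-! ### The greedy spanning tree -/

/-- The weighted number of columns in which the rows `a` and `b` differ, where column `j` has
weight `2 ^ κ j`. -/
def weightedDist {N : ℕ} (S : Matrix (Fin N) (Fin N) ℤˣ) (κ : Fin N → ℕ) (a b : Fin N) : ℕ :=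
  ∑ j, if S a j ≠ S b j then 2 ^ κ j else 0

/-- A state of the greedy construction of a spanning tree on the rows: the rows
`idx 0, …, idx (M - 1)` are still active, every other row has been attached to some row, and
`κ j` bounds the number of tree edges whose ends differ in column `j`. -/
structure GreedyState {N : ℕ} (S : Matrix (Fin N) (Fin N) ℤˣ) (M : ℕ) (idx : ℕ → Fin N)
    (κ : Fin N → ℕ) : Prop where
  extend : ∀ L : List (Fin N), (∀ p < M, idx p ∈ L) → ∃ L' : List (Fin N), (∀ i, i ∈ L') ∧
    ∀ j, (L'.map fun i => S i j).changes ≤ (L.map fun i => S i j).changes + 2 * κ j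
  weight : ∑ j, (2 : ℝ) ^ κ j ≤
    N * Real.exp (∑ m ∈ Finset.Ioc M N, 10 * signRank S / Real.log m)
  count : ∀ j, κ j + M ≤ N

theorem GreedyState.initial {N : ℕ} (S : Matrix (Fin N) (Fin N) ℤˣ) (idx : ℕ → Fin N)
    (h : ∀ p < N, (idx p : ℕ) = p) : GreedyState S N idx fun _ => 0 where
  extend L hL := ⟨L, fun i => by
    have := hL i i.2
    rwa [show idx i = i from Fin.ext (h i i.2)] at this, fun j => by simp⟩
  weight := by simp
  count := by simp

/-- Retiring row `k` attaches it to row `i`: in any list it can be inserted right behind `i`, at the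
price of two changes in each column separating the two. The last active row fills the freed slot. -/
theorem GreedyState.step {N : ℕ} {S : Matrix (Fin N) (Fin N) ℤˣ} {M : ℕ} {idx : ℕ → Fin N}
    {κ : Fin N → ℕ} (hs : GreedyState S (M + 1) idx κ) (hMN : M + 1 ≤ N) {i k : ℕ} (hik : i < k)
    (hk : k < M + 1)
    (hmin : ∀ i' k', i' < k' → k' < M + 1 →
      weightedDist S κ (idx i) (idx k) ≤ weightedDist S κ (idx i') (idx k')) :
    GreedyState S M (Function.update idx k (idx M))
      (fun j => κ j + if S (idx i) j ≠ S (idx k) j then 1 else 0) where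
  extend L hL := by
    have hi : idx i ∈ L := by
      have := hL i (by omega)
      rwa [Function.update_of_ne (by omega)] at this
    obtain ⟨l₁, l₂, rfl⟩ := List.append_of_mem hi
    obtain ⟨L', hL', hch⟩ := hs.extend (l₁ ++ idx i :: idx k :: l₂) (by
      intro p hp
      have hsub : ∀ r, r ∈ l₁ ++ idx i :: l₂ → r ∈ l₁ ++ idx i :: idx k :: l₂ := by
        intro r hr
        simp only [List.mem_append, List.mem_cons] at hr ⊢
        tauto
      by_cases hpk : p = k
      · subst hpk; simp
      · by_cases hpM : p = M
        · subst hpM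
          have := hL k (by omega)
          rw [Function.update_self] at this
          exact hsub _ this
        · have := hL p (by omega)
          rw [Function.update_of_ne hpk] at this
          exact hsub _ this)
    refine ⟨L', hL', fun j => (hch j).trans ?_⟩
    have := List.changes_insert_le (S (idx i) j) (S (idx k) j) (l₂.map fun i => S i j)
      (l₁.map fun i => S i j)
    simp only [List.map_append, List.map_cons]
    by_cases h : S (idx k) j = S (idx i) j
    · simp only [h, if_true] at this ⊢; simp; omega
    · have h' : S (idx i) j ≠ S (idx k) j := fun e => h e.symm
      simp only [h, if_false] at this
      simp only [h', ne_eq, not_false_eq_true, if_true]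
      omega
  weight := by
    have hpos : 1 ≤ signRank S := signRank_pos S (idx 0) (idx 0)
    have : Nonempty (Fin N) := ⟨idx 0⟩
    have hW : 0 < ∑ j, (2 : ℝ) ^ κ j :=
      Finset.sum_pos (fun j _ => by positivity) Finset.univ_nonempty
    obtain ⟨a, b, hab, hb, hclose⟩ := exists_close_pair S (M := M + 1) (by omega) idx
      (fun j => (2 : ℝ) ^ κ j) (fun j => by positivity) hW hpos
    have hcast : ∀ a b, (weightedDist S κ a b : ℝ) =
        ∑ j, if S a j ≠ S b j then (2 : ℝ) ^ κ j else 0 := by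
      intro a b
      rw [weightedDist, Nat.cast_sum]
      refine Finset.sum_congr rfl fun j _ => ?_
      split_ifs <;> simp
    -- The chosen pair minimizes the distance, hence is no farther apart than the pair from the
    -- packing bound.
    have hle : (weightedDist S κ (idx i) (idx k) : ℝ) ≤
        10 * signRank S / Real.log (M + 1 : ℕ) * ∑ j, (2 : ℝ) ^ κ j := by
      refine le_trans ?_ hclose
      rw [← hcast]
      exact_mod_cast hmin a b hab hb
    set δ : ℝ := 10 * signRank S / Real.log (M + 1 : ℕ) with hδ
    have hIoc : Finset.Ioc M N = insert (M + 1) (Finset.Ioc (M + 1) N) := by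
      ext m; simp only [Finset.mem_Ioc, Finset.mem_insert]; omega
    -- Doubling the separating columns adds exactly their old weight, the distance of the pair.
    have hnew : ∑ j, (2 : ℝ) ^ (κ j + if S (idx i) j ≠ S (idx k) j then 1 else 0) =
        ∑ j, (2 : ℝ) ^ κ j + weightedDist S κ (idx i) (idx k) := by
      rw [hcast, ← Finset.sum_add_distrib]
      refine Finset.sum_congr rfl fun j _ => ?_
      split_ifs <;> ring
    rw [hnew, hIoc, Finset.sum_insert (by simp), ← hδ, Real.exp_add]
    have h1 : 1 + δ ≤ Real.exp δ := by linarith [Real.add_one_le_exp δ]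
    calc ∑ j, (2 : ℝ) ^ κ j + weightedDist S κ (idx i) (idx k)
        ≤ (1 + δ) * ∑ j, (2 : ℝ) ^ κ j := by linarith
      _ ≤ Real.exp δ * ∑ j, (2 : ℝ) ^ κ j := mul_le_mul_of_nonneg_right h1 hW.le
      _ ≤ Real.exp δ * (N * Real.exp (∑ m ∈ Finset.Ioc (M + 1) N,
            10 * signRank S / Real.log m)) :=
          mul_le_mul_of_nonneg_left hs.weight (Real.exp_pos _).le
      _ = _ := by ring
  count j := by
    have := hs.count j
    split_ifs <;> omega

theorem GreedyState.signRank_le {N : ℕ} {S : Matrix (Fin N) (Fin N) ℤˣ} {idx : ℕ → Fin N}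
    {κ : Fin N → ℕ} (hs : GreedyState S 1 idx κ) {K : ℕ} (hK : ∀ j, κ j ≤ K) :
    signRank S ≤ 2 * K + 1 := by
  obtain ⟨L, hL, hch⟩ := hs.extend [idx 0] (by
    intro p hp
    obtain rfl : p = 0 := by omega
    simp)
  refine signRank_le_of_changes S L hL (2 * K) fun j => (hch j).trans ?_
  have := hK j
  simp only [List.map_cons, List.map_nil, List.changes]
  omega

theorem GreedyState.le_signRank {N : ℕ} (hN : 2 ≤ N) {S : Matrix (Fin N) (Fin N) ℤˣ}
    {idx : ℕ → Fin N} {κ : Fin N → ℕ} (hs : GreedyState S 1 idx κ) (j : Fin N) :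
    ((2 * κ j + 1 : ℕ) : ℝ) ≤ 200 * (N / Real.log N) * signRank S := by
  have hd : (1 : ℝ) ≤ signRank S := by exact_mod_cast signRank_pos S j j
  have hNR : (2 : ℝ) ≤ N := by exact_mod_cast hN
  have hlog : 0 < Real.log N := Real.log_pos (by linarith)
  set q : ℝ := N / Real.log N with hq
  have hqlog : Real.log N ≤ 4 * q := by
    rw [hq, ← mul_div_assoc, le_div_iff₀ hlog]
    have := Real.log_le_two_mul_sqrt (x := (N : ℝ)) (by linarith)
    have h3 := Real.mul_self_sqrt (x := (N : ℝ)) (by linarith)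
    nlinarith
  have hq1 : 1 ≤ q := by
    rw [hq, le_div_iff₀ hlog]
    linarith [Real.log_le_sub_one_of_pos (x := (N : ℝ)) (by linarith)]
  have hle : (2 : ℝ) ^ κ j ≤ N * Real.exp (∑ m ∈ Finset.Ioc 1 N, 10 * signRank S / Real.log m) :=
    (Finset.single_le_sum (f := fun j => (2 : ℝ) ^ κ j) (fun j _ => by positivity)
      (Finset.mem_univ j)).trans hs.weight
  have h1 := Real.log_le_log (by positivity) hle
  rw [Real.log_pow, Real.log_mul (by linarith) (Real.exp_pos _).ne', Real.log_exp] at h1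
  have h2 : ∑ m ∈ Finset.Ioc 1 N, 10 * (signRank S : ℝ) / Real.log m =
      10 * signRank S * ∑ m ∈ Finset.Ioc 1 N, (Real.log m)⁻¹ := by
    rw [Finset.mul_sum]; rfl
  have h3 := mul_le_mul_of_nonneg_left (sum_inv_log_le hN)
    (by linarith : (0 : ℝ) ≤ 10 * signRank S)
  rw [← h2] at h3
  have hl2 := Real.log_two_gt_d9
  have hqd : q ≤ q * signRank S := by nlinarith
  have h4 : (κ j : ℝ) * 0.69 ≤ κ j * Real.log 2 :=
    mul_le_mul_of_nonneg_left (by linarith) (Nat.cast_nonneg _)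
  -- Here 54 = 4 + 10 · 5, from log N ≤ 4q and from the sum of inverse logarithms. As 2 · 54 / 0.69
  -- + 1 < 200, the final constant follows.
  have h5 : (κ j : ℝ) * 0.69 ≤ 54 * (q * signRank S) := by
    rw [← hq] at h3
    linarith
  push_cast
  linarith

/-! ### Cost bounds and a Hoare calculus with running times -/

namespace RAM

/-- A bound for the number of nodes of a term in which a constant `n` counts `n + 1`. -/
def Term.nodes : Term → ℕ
  | lit n => n + 1
  | reg _ => 1
  | get _ e => e.nodes + 1
  | add e f => e.nodes + f.nodes + 1
  | sub e f => e.nodes + f.nodes + 1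
  | mul e f => e.nodes + f.nodes + 1

/-- Every number in the store has at most `b` binary digits. -/
def Store.Bdd (b : ℕ) (s : Store) : Prop :=
  (∀ x, s.reg x < 2 ^ b) ∧ ∀ a k, s.arr a k < 2 ^ b

theorem Store.Bdd.update_reg {b : ℕ} {s : Store} (hs : s.Bdd b) (x : ℕ) {v : ℕ} (hv : v < 2 ^ b) :
    Store.Bdd b ⟨Function.update s.reg x v, s.arr⟩ := by
  refine ⟨fun y => ?_, hs.2⟩
  by_cases h : y = x
  · subst h; simpa using hv
  · simpa [Function.update_of_ne h] using hs.1 y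

theorem Store.Bdd.update_arr {b : ℕ} {s : Store} (hs : s.Bdd b) (a k : ℕ) {v : ℕ}
    (hv : v < 2 ^ b) :
    Store.Bdd b ⟨s.reg, Function.update s.arr a (Function.update (s.arr a) k v)⟩ := by
  refine ⟨hs.1, fun a' k' => ?_⟩
  by_cases h : a' = a
  · subst h
    by_cases h' : k' = k
    · subst h'; simpa using hv
    · simpa [Function.update_of_ne h'] using hs.2 a' k'
  · simpa [Function.update_of_ne h] using hs.2 a' k'

/-- A product adds digit counts and a sum needs one digit more than its larger summand, so the
digits grow at most linearly with the nodes. Constants are covered by n < 2 ^ (n + 1). -/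
theorem Term.val_lt {b : ℕ} (hb : 1 ≤ b) {s : Store} (hs : s.Bdd b) (e : Term) :
    e.val s < 2 ^ (b * e.nodes) := by
  have hadd : ∀ m n u v : ℕ, u < 2 ^ (b * m) → v < 2 ^ (b * n) →
      u + v < 2 ^ (b * (m + n + 1)) := by
    intro m n u v hu hv
    have h1 : 2 ^ (b * m) ≤ 2 ^ (b * (m + n)) := Nat.pow_le_pow_right (by norm_num) (by gcongr; omega)
    have h2 : 2 ^ (b * n) ≤ 2 ^ (b * (m + n)) := Nat.pow_le_pow_right (by norm_num) (by gcongr; omega)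
    have h3 : 2 ^ (b * (m + n) + 1) ≤ 2 ^ (b * (m + n + 1)) :=
      Nat.pow_le_pow_right (by norm_num) (by rw [mul_add b (m + n)]; omega)
    rw [pow_succ] at h3
    omega
  induction e with
  | lit n =>
    calc n < n + 1 := Nat.lt_succ_self n
      _ < 2 ^ (n + 1) := Nat.lt_two_pow_self
      _ ≤ 2 ^ (b * (n + 1)) := Nat.pow_le_pow_right (by norm_num) (by nlinarith)
  | reg x => simpa [Term.nodes, Term.val] using hs.1 x
  | get a e ih =>
    exact (hs.2 a _).trans_le (Nat.pow_le_pow_right (by norm_num) (by simp only [nodes]; nlinarith))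
  | add e f he hf => exact hadd _ _ _ _ he hf
  | sub e f he hf =>
    exact (Nat.sub_le _ _).trans_lt ((Nat.le_add_right _ _).trans_lt (hadd _ _ _ _ he hf))
  | mul e f he hf =>
    calc e.val s * f.val s < 2 ^ (b * e.nodes) * 2 ^ (b * f.nodes) := Nat.mul_lt_mul'' he hf
      _ = 2 ^ (b * e.nodes + b * f.nodes) := (pow_add _ _ _).symm
      _ ≤ 2 ^ (b * (e.nodes + f.nodes + 1)) := Nat.pow_le_pow_right (by norm_num) (by nlinarith)

theorem Term.cost_le {b : ℕ} (hb : 1 ≤ b) {s : Store} (hs : s.Bdd b) (e : Term) :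
    e.cost s ≤ e.nodes * (1 + b * e.nodes) := by
  have hsize : ∀ e : Term, Nat.size (e.val s) ≤ b * e.nodes := fun e =>
    Nat.size_le.2 (e.val_lt hb hs)
  induction e with
  | lit n =>
    have := hsize (lit n)
    simp only [cost, nodes, val] at this ⊢
    nlinarith
  | reg x =>
    have := hsize (reg x)
    simp only [cost, nodes, val] at this ⊢
    omega
  | get a e ih =>
    have := hsize (get a e)
    simp only [cost, nodes, val] at this ⊢
    nlinarith
  | add e f he hf =>
    have := hsize (add e f)
    simp only [cost, nodes, val] at this ⊢
    nlinarith [Nat.zero_le (b * e.nodes * f.nodes)]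
  | sub e f he hf =>
    have := hsize (sub e f)
    simp only [cost, nodes, val] at this ⊢
    nlinarith [Nat.zero_le (b * e.nodes * f.nodes)]
  | mul e f he hf =>
    have := hsize (mul e f)
    simp only [cost, nodes, val] at this ⊢
    nlinarith [Nat.zero_le (b * e.nodes * f.nodes)]

/-- A time bound for assignments and tests whose terms have at most `50` nodes, on numbers with
at most `b` binary digits. -/
def unitTime {R : Type*} [CommSemiring R] (b : R) : R := 1 + 2 * (50 * (1 + b * 50))

theorem Term.cost_le_of_nodes {b : ℕ} (hb : 1 ≤ b) {s : Store} (hs : s.Bdd b) {e : Term}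
    (he : e.nodes ≤ 50) : e.cost s ≤ 50 * (1 + b * 50) :=
  (e.cost_le hb hs).trans (by gcongr)

/-- Total correctness with time bound `T` on stores of numbers with at most `b` digits. -/
def Triple (b T : ℕ) (P : Store → Prop) (p : Prog) (Q : Store → Prop) : Prop :=
  ∀ s : Store, s.Bdd b → P s → ∃ t s', Exec p s t s' ∧ t ≤ T ∧ s'.Bdd b ∧ Q s'

theorem Triple.mono_time {b T T' : ℕ} {P Q : Store → Prop} {p : Prog} (h : Triple b T P p Q)
    (hT : T ≤ T') : Triple b T' P p Q := fun s hs hP => by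
  obtain ⟨t, s', he, ht, hb, hQ⟩ := h s hs hP
  exact ⟨t, s', he, ht.trans hT, hb, hQ⟩

theorem Triple.skip {b : ℕ} {P Q : Store → Prop} (h : ∀ s, P s → Q s) :
    Triple b 1 P .skip Q :=
  fun s hs hP => ⟨1, s, .skip s, le_rfl, hs, h s hP⟩

theorem Triple.assign {b : ℕ} (hb : 1 ≤ b) {P Q : Store → Prop} {x : ℕ} {e : Term}
    (he : e.nodes ≤ 50)
    (h : ∀ s, s.Bdd b → P s → e.val s < 2 ^ b ∧ Q ⟨Function.update s.reg x (e.val s), s.arr⟩) :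
    Triple b (unitTime b) P (.assign x e) Q := fun s hs hP => by
  obtain ⟨hv, hQ⟩ := h s hs hP
  refine ⟨_, _, .assign x e s, ?_, hs.update_reg x hv, hQ⟩
  have := e.cost_le_of_nodes hb hs he
  unfold unitTime
  omega

theorem Triple.put {b : ℕ} (hb : 1 ≤ b) {P Q : Store → Prop} {a : ℕ} {e f : Term}
    (he : e.nodes ≤ 50) (hf : f.nodes ≤ 50)
    (h : ∀ s, s.Bdd b → P s → f.val s < 2 ^ b ∧
      Q ⟨s.reg, Function.update s.arr a (Function.update (s.arr a) (e.val s) (f.val s))⟩) :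
    Triple b (unitTime b) P (.put a e f) Q := fun s hs hP => by
  obtain ⟨hv, hQ⟩ := h s hs hP
  refine ⟨_, _, .put a e f s, ?_, hs.update_arr a _ hv, hQ⟩
  have := e.cost_le_of_nodes hb hs he
  have := f.cost_le_of_nodes hb hs hf
  unfold unitTime
  omega

theorem Triple.seq {b T T' : ℕ} {P Q R : Store → Prop} {p q : Prog} (hp : Triple b T P p Q)
    (hq : Triple b T' Q q R) : Triple b (T + T') P (.seq p q) R := fun s hs hP => by
  obtain ⟨t, s', he, ht, hs', hQ⟩ := hp s hs hP
  obtain ⟨t', s'', he', ht', hs'', hR⟩ := hq s' hs' hQ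
  exact ⟨_, _, .seq he he', by omega, hs'', hR⟩

theorem Triple.ite {b T : ℕ} (hb : 1 ≤ b) {P Q : Store → Prop} {e : Term} {p q : Prog}
    (he : e.nodes ≤ 50) (hp : Triple b T (fun s => P s ∧ e.val s ≠ 0) p Q)
    (hq : Triple b T (fun s => P s ∧ e.val s = 0) q Q) :
    Triple b (unitTime b + T) P (.ite e p q) Q := fun s hs hP => by
  have hc := e.cost_le_of_nodes hb hs he
  by_cases h : e.val s = 0
  · obtain ⟨t, s', he, ht, hs', hQ⟩ := hq s hs ⟨hP, h⟩
    refine ⟨_, _, .ite_false h he, ?_, hs', hQ⟩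
    unfold unitTime
    omega
  · obtain ⟨t, s', he, ht, hs', hQ⟩ := hp s hs ⟨hP, h⟩
    refine ⟨_, _, .ite_true h he, ?_, hs', hQ⟩
    unfold unitTime
    omega

/-- The index of `I` counts the rounds still to run; as the test vanishes exactly at index 0,
induction on it gives termination and time together. -/
theorem Triple.loop {b T : ℕ} (hb : 1 ≤ b) {e : Term} {p : Prog} (he : e.nodes ≤ 50)
    (I : ℕ → Store → Prop) (h0 : ∀ s, I 0 s → e.val s = 0)
    (h1 : ∀ m s, I (m + 1) s → e.val s ≠ 0) (n : ℕ)
    (hp : ∀ m < n, Triple b T (I (m + 1)) p (I m)) :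
    Triple b (unitTime b + n * (T + unitTime b)) (I n) (.loop e p) (I 0) := by
  induction n with
  | zero =>
    intro s hs hI
    refine ⟨_, _, .loop_false (h0 s hI), ?_, hs, hI⟩
    have := e.cost_le_of_nodes hb hs he
    unfold unitTime
    omega
  | succ n ih =>
    intro s hs hI
    obtain ⟨t, s', hex, ht, hs', hI'⟩ := hp n (Nat.lt_succ_self n) s hs hI
    obtain ⟨t', s'', hex', ht', hs'', hI''⟩ :=
      ih (fun m hm => hp m (hm.trans (Nat.lt_succ_self n))) s' hs' hI'
    refine ⟨_, _, .loop_true (h1 n s hI) hex hex', ?_, hs'', hI''⟩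
    have hc := e.cost_le_of_nodes hb hs he
    have hu : 1 + e.cost s ≤ unitTime b := by
      unfold unitTime
      omega
    calc 1 + e.cost s + t + t' ≤ unitTime b + T + (unitTime b + n * (T + unitTime b)) := by omega
      _ = unitTime b + (n + 1) * (T + unitTime b) := by ring

/-- Run `p` for the values `0, 1, …, e - 1` of the register `x`. -/
def forLoop (x : ℕ) (e : Term) (p : Prog) : Prog :=
  .seq (.assign x (.lit 0))
    (.loop (.sub e (.reg x)) (.seq p (.assign x (.add (.reg x) (.lit 1)))))

/-- A time bound for at most `n` rounds of a loop whose body runs in time `T`, where tests and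
assignments run in time `u`. -/
def forTime {R : Type*} [CommSemiring R] (u n T : R) : R := 2 * u + n * (T + 2 * u)

/-- Here the index of `I` is the counter itself. The body must establish the invariant for the store
with the counter already increased. The separate bound `N` keeps the time uniform when the number
`n` of rounds varies, as in nested loops. -/
theorem Triple.forLoop {b T n N : ℕ} (hb : 1 ≤ b) (hn : n < 2 ^ b) (hnN : n ≤ N) {x : ℕ} {e : Term}
    {p : Prog} (he : e.nodes ≤ 48) {P : Store → Prop} (I : ℕ → Store → Prop)
    (hx : ∀ i s, I i s → s.reg x = i) (hval : ∀ i s, I i s → e.val s = n)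
    (hinit : ∀ s, P s → I 0 ⟨Function.update s.reg x 0, s.arr⟩)
    (hp : ∀ i < n, Triple b T (I i) p
      (fun s => s.reg x = i ∧ I (i + 1) ⟨Function.update s.reg x (i + 1), s.arr⟩)) :
    Triple b (forTime (unitTime b) N T) P (RAM.forLoop x e p) (I n) := by
  have hloop := Triple.loop (T := T + unitTime b) hb (e := .sub e (.reg x))
    (p := .seq p (.assign x (.add (.reg x) (.lit 1)))) (by simp only [Term.nodes]; omega)
    (fun m s => m ≤ n ∧ I (n - m) s)
    (by
      rintro s ⟨_, hI⟩
      simp [Term.val, hval _ _ hI, hx _ _ hI])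
    (by
      rintro m s ⟨hm, hI⟩
      simp only [Term.val, hval _ _ hI, hx _ _ hI]
      omega) n
    (by
      intro m hm
      refine Triple.seq (T := T)
        (Q := fun s => s.reg x = n - (m + 1) ∧
          I (n - (m + 1) + 1) ⟨Function.update s.reg x (n - (m + 1) + 1), s.arr⟩)
        ?_ (Triple.assign hb (by simp [Term.nodes]) ?_)
      · intro s hs hI
        exact hp (n - (m + 1)) (by omega) s hs hI.2
      · rintro s hs ⟨h1, h2⟩
        have h3 : n - (m + 1) + 1 = n - m := by omega
        simp only [Term.val, h1]
        rw [h3] at h2 ⊢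
        exact ⟨by omega, hm.le, h2⟩)
  have hfirst : Triple b (unitTime b) P (.assign x (.lit 0)) (fun s => n ≤ n ∧ I (n - n) s) :=
    Triple.assign hb (by simp [Term.nodes]) fun s hs hP =>
      ⟨by simp [Term.val], le_rfl, by simpa [Term.val] using hinit s hP⟩
  have h := (hfirst.seq hloop).mono_time (T' := forTime (unitTime b) N T) (by
    unfold forTime
    have : n * (T + unitTime b + unitTime b) ≤ N * (T + 2 * unitTime b) := by
      rw [add_assoc, ← two_mul]; gcongr
    omega)
  intro s hs hP
  obtain ⟨t, s', hex, ht, hs', _, hI⟩ := h s hs hP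
  exact ⟨t, s', hex, ht, hs', by simpa using hI⟩

end RAM

/-! ### The program -/

namespace RAM

/-- The program term for the entry of the input matrix in column `reg 4` of the row listed at
position `r` of the array `3`. -/
def entryTerm (r : Term) : Term := .get 0 (.add (.mul (.get 3 r) (.reg 0)) (.reg 4))

/-- The program term that is `1` if the rows listed at the positions `r` and `r'` differ in
column `reg 4`, and `0` otherwise. -/
def diffTerm (r r' : Term) : Term :=
  .add (.sub (entryTerm r) (entryTerm r')) (.sub (entryTerm r') (entryTerm r))

/-- Initialize the column weights (array `1`) and the list of active rows (array `3`, of length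
`reg 1`). -/
def initProg : Prog :=
  .seq (forLoop 4 (.reg 0) (.seq (.put 1 (.reg 4) (.lit 1)) (.put 3 (.reg 4) (.reg 4))))
    (.assign 1 (.reg 0))

/-- Compute in register `5` one plus the weighted distance of the active rows at the positions
`reg 2` and `reg 3`. -/
def distProg : Prog :=
  .seq (.assign 5 (.lit 1))
    (forLoop 4 (.reg 0)
      (.assign 5 (.add (.reg 5) (.mul (.get 1 (.reg 4)) (diffTerm (.reg 2) (.reg 3))))))

/-- Replace the best pair of positions (registers `7` and `8`, with distance plus one in
register `6`) by the current one if that is better. -/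
def improveProg : Prog :=
  .ite (.add (.sub (.lit 1) (.reg 6)) (.sub (.reg 6) (.reg 5)))
    (.seq (.assign 6 (.reg 5)) (.seq (.assign 7 (.reg 2)) (.assign 8 (.reg 3)))) .skip

/-- Find a pair of active rows at the least weighted distance. -/
def searchProg : Prog :=
  .seq (.assign 6 (.lit 0))
    (forLoop 3 (.reg 1) (forLoop 2 (.reg 3) (.seq distProg improveProg)))

/-- Double the weight (array `1`) of every column in which the chosen rows differ, and count
these doublings (array `2`). -/
def updateProg : Prog :=
  forLoop 4 (.reg 0)
    (.seq
      (.put 1 (.reg 4)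
        (.add (.get 1 (.reg 4)) (.mul (.get 1 (.reg 4)) (diffTerm (.reg 7) (.reg 8)))))
      (.put 2 (.reg 4) (.add (.get 2 (.reg 4)) (diffTerm (.reg 7) (.reg 8)))))

/-- Delete the second of the chosen rows from the list of active rows. -/
def deleteProg : Prog :=
  .seq (.assign 1 (.sub (.reg 1) (.lit 1))) (.put 3 (.reg 8) (.get 3 (.reg 1)))

/-- Compute one plus twice the largest number of doublings. -/
def outputProg : Prog :=
  .seq (.assign 5 (.lit 0))
    (.seq (forLoop 4 (.reg 0) (.assign 5 (.add (.reg 5) (.sub (.get 2 (.reg 4)) (.reg 5)))))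
      (.assign 0 (.add (.mul (.lit 2) (.reg 5)) (.lit 1))))

/-- The approximation algorithm for the sign rank. -/
def signRankProg : Prog :=
  .seq initProg
    (.seq (.loop (.sub (.reg 1) (.lit 1)) (.seq searchProg (.seq updateProg deleteProg)))
      outputProg)

/-! ### Correctness and running time of the program -/

theorem input_arr {N : ℕ} (S : Matrix (Fin N) (Fin N) ℤˣ) (i j : Fin N) :
    (input S).arr 0 (i * N + j) = if S i j = 1 then 1 else 0 := by
  have hlt : (i : ℕ) * N + j < N * N := by
    have h1 : ((i : ℕ) + 1) * N ≤ N * N := Nat.mul_le_mul_right N i.2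
    have := j.2
    linarith
  have hdiv : Fin.divNat (⟨(i : ℕ) * N + j, hlt⟩ : Fin (N * N)) = i := by
    apply Fin.ext
    simp only [Fin.coe_divNat]
    rw [mul_comm, Nat.mul_add_div (by have := j.2; omega), Nat.div_eq_of_lt j.2, add_zero]
  have hmod : Fin.modNat (⟨(i : ℕ) * N + j, hlt⟩ : Fin (N * N)) = j := by
    apply Fin.ext
    simp only [Fin.coe_modNat]
    rw [mul_comm, Nat.mul_add_mod, Nat.mod_eq_of_lt j.2]
  simp [input, hlt, hdiv, hmod]

/-- The part of the store that holds the input and the list of active rows. -/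
structure Rows {N : ℕ} (S : Matrix (Fin N) (Fin N) ℤˣ) (M : ℕ) (idx : ℕ → Fin N)
    (s : Store) : Prop where
  size : s.reg 0 = N
  active : s.reg 1 = M
  input : s.arr 0 = (input S).arr 0
  list : ∀ p < M, s.arr 3 p = idx p

/-- The part of the store that holds the column weights and the numbers of doublings. -/
structure Weights {N : ℕ} (κ : Fin N → ℕ) (s : Store) : Prop where
  weight : ∀ j : Fin N, s.arr 1 j = 2 ^ κ j
  count : ∀ j : Fin N, s.arr 2 j = κ j

/-- The sum of both truncated differences is the absolute difference, here of two bits. -/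
theorem Rows.diffTerm_val {N : ℕ} {S : Matrix (Fin N) (Fin N) ℤˣ} {M : ℕ} {idx : ℕ → Fin N}
    {s : Store} (hs : Rows S M idx s) {r r' : Term} {i k : ℕ} (hr : r.val s = i)
    (hr' : r'.val s = k) (hi : i < M) (hk : k < M) (j : Fin N) (hj : s.reg 4 = j) :
    (diffTerm r r').val s = if S (idx i) j ≠ S (idx k) j then 1 else 0 := by
  simp only [diffTerm, entryTerm, Term.val, hr, hr', hs.list i hi, hs.list k hk, hs.size, hj,
    hs.input, input_arr]
  rcases Int.units_eq_one_or (S (idx i) j) with h1 | h1 <;>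
    rcases Int.units_eq_one_or (S (idx k) j) with h2 | h2 <;> simp [h1, h2]

theorem lt_two_pow_of_le {N v : ℕ} (h : v ≤ 2 * N + 1) : v < 2 ^ (2 * N + 2) :=
  lt_of_le_of_lt (by omega : v ≤ 2 * N + 2) Nat.lt_two_pow_self

theorem initProg_spec {N : ℕ} (S : Matrix (Fin N) (Fin N) ℤˣ) (idx : ℕ → Fin N)
    (hidx : ∀ p < N, (idx p : ℕ) = p) :
    Triple (2 * N + 2) (forTime (unitTime (2 * N + 2)) N (unitTime (2 * N + 2) +
        unitTime (2 * N + 2)) + unitTime (2 * N + 2))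
      (fun s => s = input S) initProg
      (fun s => Rows S N idx s ∧ Weights (fun _ : Fin N => 0) s) := by
  refine Triple.seq (Q := fun s => s.reg 0 = N ∧ s.arr 0 = (input S).arr 0 ∧
    (∀ j < N, s.arr 1 j = 1) ∧ (∀ j, s.arr 2 j = 0) ∧ ∀ j < N, s.arr 3 j = j) ?_ ?_
  · have h := Triple.forLoop (b := 2 * N + 2) (n := N) (N := N)
      (T := unitTime (2 * N + 2) + unitTime (2 * N + 2)) (by omega)
      (lt_two_pow_of_le (by omega)) le_rfl (x := 4) (e := .reg 0)
      (p := .seq (.put 1 (.reg 4) (.lit 1)) (.put 3 (.reg 4) (.reg 4))) (by simp [Term.nodes])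
      (P := fun s => s = input S)
      (fun i s => s.reg 4 = i ∧ s.reg 0 = N ∧ s.arr 0 = (input S).arr 0 ∧
        (∀ j < i, s.arr 1 j = 1) ∧ (∀ j, s.arr 2 j = 0) ∧ ∀ j < i, s.arr 3 j = j)
      (fun i s h => h.1) (fun i s h => by simpa [Term.val] using h.2.1)
      (by
        rintro s rfl
        simp [input])
      (by
        intro i hi
        refine Triple.seq (Q := fun s => s.reg 4 = i ∧ s.reg 0 = N ∧ s.arr 0 = (input S).arr 0 ∧
          (∀ j < i + 1, s.arr 1 j = 1) ∧ (∀ j, s.arr 2 j = 0) ∧ ∀ j < i, s.arr 3 j = j)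
          (Triple.put (by omega) (by simp [Term.nodes]) (by simp [Term.nodes]) ?_)
          (Triple.put (by omega) (by simp [Term.nodes]) (by simp [Term.nodes]) ?_)
        · rintro s - ⟨h4, h0, ha, h1, h2, h3⟩
          refine ⟨by simp [Term.val], by simpa using h4, by simpa using h0, by simpa using ha, ?_,
            by simpa using h2, by simpa using h3⟩
          intro j hj
          simp only [Term.val, h4, Function.update_self]
          by_cases h : j = i
          · simp [h]
          · rw [Function.update_of_ne h]; exact h1 j (by omega)
        · rintro s - ⟨h4, h0, ha, h1, h2, h3⟩
          refine ⟨by simp only [Term.val, h4]; exact lt_two_pow_of_le (by omega),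
            by simpa using h4, by simp, by simpa using h0, by simpa using ha,
            by simpa using h1, by simpa using h2, ?_⟩
          intro j hj
          simp only [Term.val, h4, Function.update_self]
          by_cases h : j = i
          · simp [h]
          · rw [Function.update_of_ne h]; exact h3 j (by omega))
    intro s hs hP
    obtain ⟨t, s', hex, ht, hs', hI⟩ := h s hs hP
    exact ⟨t, s', hex, ht, hs', hI.2⟩
  · refine Triple.assign (by omega) (by simp [Term.nodes]) ?_
    rintro s - ⟨h0, ha, h1, h2, h3⟩
    refine ⟨by simp only [Term.val, h0]; exact lt_two_pow_of_le (by omega), ⟨?_, ?_, ?_, ?_⟩, ⟨?_, ?_⟩⟩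
    · simpa using h0
    · simpa [Term.val] using h0
    · simpa using ha
    · intro p hp
      simpa [hidx p hp] using h3 p hp
    · intro j
      simpa using h1 j j.2
    · intro j
      simpa using h2 j

/-- This is what fixes the digit bound 2N + 2: distances are the largest numbers the program has to
store. -/
theorem weightedDist_lt {N : ℕ} (S : Matrix (Fin N) (Fin N) ℤˣ) (κ : Fin N → ℕ)
    (hκ : ∀ j, κ j ≤ N) (a b : Fin N) : 1 + weightedDist S κ a b < 2 ^ (2 * N + 2) := by
  have h1 : weightedDist S κ a b ≤ N * 2 ^ N := by
    unfold weightedDist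
    calc _ ≤ ∑ _j : Fin N, 2 ^ N := Finset.sum_le_sum fun j _ => by
            split_ifs
            · exact Nat.pow_le_pow_right (by norm_num) (hκ j)
            · exact Nat.zero_le _
      _ = N * 2 ^ N := by simp
  have h2 : N < 2 ^ N := Nat.lt_two_pow_self
  have h3 : 2 ^ (2 * N + 2) = 4 * (2 ^ N * 2 ^ N) := by ring
  rw [h3]
  nlinarith

/-- The values `v₆`, `v₇`, `v₈` are a frame condition: computing a distance leaves the recorded best
pair intact. -/
theorem distProg_spec {N : ℕ} (S : Matrix (Fin N) (Fin N) ℤˣ) {M : ℕ} (idx : ℕ → Fin N)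
    (κ : Fin N → ℕ) (hκ : ∀ j, κ j ≤ N) {i k : ℕ} (hi : i < M) (hk : k < M) (v₆ v₇ v₈ : ℕ) :
    Triple (2 * N + 2)
      (unitTime (2 * N + 2) + forTime (unitTime (2 * N + 2)) N (unitTime (2 * N + 2)))
      (fun s => Rows S M idx s ∧ Weights κ s ∧ s.reg 2 = i ∧ s.reg 3 = k ∧
        s.reg 6 = v₆ ∧ s.reg 7 = v₇ ∧ s.reg 8 = v₈) distProg
      (fun s => Rows S M idx s ∧ Weights κ s ∧ s.reg 2 = i ∧ s.reg 3 = k ∧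
        s.reg 6 = v₆ ∧ s.reg 7 = v₇ ∧ s.reg 8 = v₈ ∧
        s.reg 5 = 1 + weightedDist S κ (idx i) (idx k)) := by
  set g : ℕ → ℕ := fun j => if h : j < N then
    (if S (idx i) ⟨j, h⟩ ≠ S (idx k) ⟨j, h⟩ then 2 ^ κ ⟨j, h⟩ else 0) else 0 with hg
  have hsum : ∑ j ∈ Finset.range N, g j = weightedDist S κ (idx i) (idx k) := by
    rw [Finset.sum_range, weightedDist]
    exact Finset.sum_congr rfl fun j _ => by simp [hg]
  refine Triple.seq (Q := fun s => Rows S M idx s ∧ Weights κ s ∧ s.reg 2 = i ∧ s.reg 3 = k ∧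
        s.reg 6 = v₆ ∧ s.reg 7 = v₇ ∧ s.reg 8 = v₈ ∧ s.reg 5 = 1)
      (Triple.assign (by omega) (by simp [Term.nodes]) ?_) ?_
  · rintro s - ⟨⟨r0, r1, ra, rl⟩, ⟨w1, w2⟩, h2, h3, h6, h7, h8⟩
    exact ⟨by simp [Term.val], ⟨by simpa using r0, by simpa using r1, ra, rl⟩, ⟨w1, w2⟩,
      by simpa using h2, by simpa using h3, by simpa using h6, by simpa using h7,
      by simpa using h8, by simp [Term.val]⟩
  · have h := Triple.forLoop (b := 2 * N + 2) (n := N) (N := N)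
      (T := unitTime (2 * N + 2)) (by omega)
      (lt_two_pow_of_le (by omega)) le_rfl (x := 4) (e := .reg 0)
      (p := .assign 5 (.add (.reg 5) (.mul (.get 1 (.reg 4)) (diffTerm (.reg 2) (.reg 3)))))
      (by simp [Term.nodes])
      (P := fun s => Rows S M idx s ∧ Weights κ s ∧ s.reg 2 = i ∧ s.reg 3 = k ∧
        s.reg 6 = v₆ ∧ s.reg 7 = v₇ ∧ s.reg 8 = v₈ ∧ s.reg 5 = 1)
      (fun j s => s.reg 4 = j ∧ Rows S M idx s ∧ Weights κ s ∧ s.reg 2 = i ∧ s.reg 3 = k ∧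
        s.reg 6 = v₆ ∧ s.reg 7 = v₇ ∧ s.reg 8 = v₈ ∧ s.reg 5 = 1 + ∑ j' ∈ Finset.range j, g j')
      (fun i s h => h.1) (fun i s h => by simpa [Term.val] using h.2.1.size)
      (by
        rintro s ⟨⟨r0, r1, ra, rl⟩, ⟨w1, w2⟩, h2, h3, h6, h7, h8, h5⟩
        exact ⟨by simp, ⟨by simpa using r0, by simpa using r1, ra, rl⟩, ⟨w1, w2⟩,
          by simpa using h2, by simpa using h3, by simpa using h6, by simpa using h7,
          by simpa using h8, by simpa using h5⟩)
      (by
        intro j hj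
        refine Triple.assign (by omega) (by simp [Term.nodes, diffTerm, entryTerm]) ?_
        rintro s - ⟨h4, hR, hW, h2, h3, h6, h7, h8, h5⟩
        have hdiff := hR.diffTerm_val (r := .reg 2) (r' := .reg 3) h2 h3 hi hk ⟨j, hj⟩ h4
        have hval : (Term.add (.reg 5) (.mul (.get 1 (.reg 4)) (diffTerm (.reg 2) (.reg 3)))).val s
            = 1 + ∑ j' ∈ Finset.range (j + 1), g j' := by
          have hw := hW.weight ⟨j, hj⟩
          simp only at hw
          simp only [Term.val, hdiff, h5, h4, hw, Finset.sum_range_succ]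
          simp only [hg, hj, dif_pos]
          split_ifs <;> ring
        have hle : ∑ j' ∈ Finset.range (j + 1), g j' ≤ weightedDist S κ (idx i) (idx k) := by
          rw [← hsum]
          exact Finset.sum_le_sum_of_subset (Finset.range_mono hj)
        rw [hval]
        obtain ⟨r0, r1, ra, rl⟩ := hR
        obtain ⟨w1, w2⟩ := hW
        exact ⟨lt_of_le_of_lt (by omega) (weightedDist_lt S κ hκ (idx i) (idx k)),
          by simpa using h4, by simp, ⟨by simpa using r0, by simpa using r1, ra, rl⟩, ⟨w1, w2⟩,
          by simpa using h2, by simpa using h3, by simpa using h6, by simpa using h7,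
          by simpa using h8, by simp⟩)
    intro s hs hP
    obtain ⟨t, s', hex, ht, hs', hI⟩ := h s hs hP
    rw [hsum] at hI
    exact ⟨t, s', hex, ht, hs', hI.2⟩

/-- The registers `6`, `7` and `8` describe the best of the pairs of positions seen so far. -/
def Best {N : ℕ} (S : Matrix (Fin N) (Fin N) ℤˣ) (idx : ℕ → Fin N) (κ : Fin N → ℕ)
    (seen : ℕ → ℕ → Prop) (s : Store) : Prop :=
  (s.reg 6 = 0 ∧ ∀ i k, ¬ seen i k) ∨
    (seen (s.reg 7) (s.reg 8) ∧
      s.reg 6 = 1 + weightedDist S κ (idx (s.reg 7)) (idx (s.reg 8)) ∧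
      ∀ i k, seen i k →
        weightedDist S κ (idx (s.reg 7)) (idx (s.reg 8)) ≤ weightedDist S κ (idx i) (idx k))

theorem Best.congr {N : ℕ} {S : Matrix (Fin N) (Fin N) ℤˣ} {idx : ℕ → Fin N} {κ : Fin N → ℕ}
    {seen seen' : ℕ → ℕ → Prop} {s s' : Store} (h : Best S idx κ seen s) (h6 : s'.reg 6 = s.reg 6)
    (h7 : s'.reg 7 = s.reg 7) (h8 : s'.reg 8 = s.reg 8) (hseen : ∀ i k, seen' i k ↔ seen i k) :
    Best S idx κ seen' s' := by
  unfold Best at h ⊢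
  simpa only [h6, h7, h8, hseen] using h

/-- The test is nonzero exactly if register 6 is 0 or exceeds register 5. Distances are stored plus
one so that 0 can mean "no pair yet". -/
theorem improveProg_spec {N : ℕ} (S : Matrix (Fin N) (Fin N) ℤˣ) {M : ℕ}
    (idx : ℕ → Fin N) (κ : Fin N → ℕ) {i k : ℕ} (hi : i < M) (hk : k < M)
    (seen seen' : ℕ → ℕ → Prop) (hseen : ∀ a b, seen' a b ↔ seen a b ∨ (a = i ∧ b = k)) :
    Triple (2 * N + 2) (unitTime (2 * N + 2) + (unitTime (2 * N + 2) +
        (unitTime (2 * N + 2) + unitTime (2 * N + 2))))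
      (fun s => Rows S M idx s ∧ Weights κ s ∧ s.reg 2 = i ∧ s.reg 3 = k ∧
        Best S idx κ seen s ∧ s.reg 5 = 1 + weightedDist S κ (idx i) (idx k)) improveProg
      (fun s => Rows S M idx s ∧ Weights κ s ∧ s.reg 2 = i ∧ s.reg 3 = k ∧
        Best S idx κ seen' s) := by
  refine Triple.ite (by omega) (by simp [Term.nodes]) ?_ ?_
  · refine Triple.seq (Q := fun s => Rows S M idx s ∧ Weights κ s ∧ s.reg 2 = i ∧ s.reg 3 = k ∧
        s.reg 6 = 1 + weightedDist S κ (idx i) (idx k) ∧ ∀ a b, seen a b →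
        weightedDist S κ (idx i) (idx k) ≤ weightedDist S κ (idx a) (idx b))
      (Triple.assign (by omega) (by simp [Term.nodes]) ?_)
      (Triple.seq (Q := fun s => Rows S M idx s ∧ Weights κ s ∧ s.reg 2 = i ∧ s.reg 3 = k ∧
        s.reg 7 = i ∧
        s.reg 6 = 1 + weightedDist S κ (idx i) (idx k) ∧ ∀ a b, seen a b →
        weightedDist S κ (idx i) (idx k) ≤ weightedDist S κ (idx a) (idx b))
      (Triple.assign (by omega) (by simp [Term.nodes]) ?_)
      (Triple.assign (by omega) (by simp [Term.nodes]) ?_))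
    · rintro s hb ⟨⟨⟨r0, r1, ra, rl⟩, ⟨w1, w2⟩, h2, h3, hB, h5⟩, hne⟩
      refine ⟨by simpa [Term.val] using hb.1 5, ⟨by simpa using r0, by simpa using r1, ra, rl⟩,
        ⟨w1, w2⟩, by simpa using h2, by simpa using h3, by simpa [Term.val] using h5, ?_⟩
      intro a b hab
      rcases hB with ⟨_, hno⟩ | ⟨_, h6, hmin⟩
      · exact absurd hab (hno a b)
      · refine le_trans ?_ (hmin a b hab)
        simp only [Term.val, h5, h6] at hne
        omega
    · rintro s hb ⟨⟨r0, r1, ra, rl⟩, ⟨w1, w2⟩, h2, h3, h6, hmin⟩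
      exact ⟨by simpa [Term.val] using hb.1 2, ⟨by simpa using r0, by simpa using r1, ra, rl⟩,
        ⟨w1, w2⟩, by simpa using h2, by simpa using h3, by simpa [Term.val] using h2,
        by simpa using h6, hmin⟩
    · rintro s hb ⟨⟨r0, r1, ra, rl⟩, ⟨w1, w2⟩, h2, h3, h7, h6, hmin⟩
      refine ⟨by simpa [Term.val] using hb.1 3, ⟨by simpa using r0, by simpa using r1, ra, rl⟩,
        ⟨w1, w2⟩, by simpa using h2, by simpa using h3, Or.inr ?_⟩
      have h7' : Function.update s.reg 8 ((Term.reg 3).val s) 7 = i := by simpa using h7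
      have h8' : Function.update s.reg 8 ((Term.reg 3).val s) 8 = k := by simpa [Term.val] using h3
      have h6' : Function.update s.reg 8 ((Term.reg 3).val s) 6 =
        1 + weightedDist S κ (idx i) (idx k) := by simpa using h6
      simp only [h7', h8', h6']
      refine ⟨(hseen i k).2 (Or.inr ⟨rfl, rfl⟩), trivial, fun a b hab => ?_⟩
      rcases (hseen a b).1 hab with h | ⟨rfl, rfl⟩
      · exact hmin a b h
      · exact le_rfl
  · refine (Triple.skip ?_).mono_time (by unfold unitTime; omega)
    rintro s ⟨⟨hR, hW, h2, h3, hB, h5⟩, he⟩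
    refine ⟨hR, hW, h2, h3, Or.inr ?_⟩
    simp only [Term.val, h5] at he
    rcases hB with ⟨h6, _⟩ | ⟨hin, h6, hmin⟩
    · omega
    · refine ⟨(hseen _ _).2 (Or.inl hin), h6, fun a b hab => ?_⟩
      rcases (hseen a b).1 hab with h | ⟨rfl, rfl⟩
      · exact hmin a b h
      · omega

theorem searchProg_spec {N : ℕ} (S : Matrix (Fin N) (Fin N) ℤˣ) {M : ℕ} (hM : M ≤ N) (hM2 : 2 ≤ M)
    (idx : ℕ → Fin N) (κ : Fin N → ℕ) (hκ : ∀ j, κ j ≤ N) {T u : ℕ} (hu : u = unitTime (2 * N + 2))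
    (hT : T = u + forTime u N u + (u + (u + (u + u)))) :
    Triple (2 * N + 2) (u + forTime u N (forTime u N T))
      (fun s => Rows S M idx s ∧ Weights κ s) searchProg
      (fun s => Rows S M idx s ∧ Weights κ s ∧ ∃ i k, s.reg 7 = i ∧ s.reg 8 = k ∧ i < k ∧ k < M ∧
        ∀ i' k', i' < k' → k' < M →
          weightedDist S κ (idx i) (idx k) ≤ weightedDist S κ (idx i') (idx k')) := by
  subst hu
  subst hT
  refine Triple.seq (Q := fun s => Rows S M idx s ∧ Weights κ s ∧ s.reg 6 = 0)
    (Triple.assign (by omega) (by simp [Term.nodes]) ?_) ?_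
  · rintro s - ⟨⟨r0, r1, ra, rl⟩, ⟨w1, w2⟩⟩
    exact ⟨by simp [Term.val], ⟨by simpa using r0, by simpa using r1, ra, rl⟩,
      ⟨w1, w2⟩, by simp [Term.val]⟩
  have houter := Triple.forLoop (b := 2 * N + 2) (n := M) (N := N)
    (T := forTime (unitTime (2 * N + 2)) N (unitTime (2 * N + 2) +
      forTime (unitTime (2 * N + 2)) N (unitTime (2 * N + 2)) + (unitTime (2 * N + 2) +
      (unitTime (2 * N + 2) + (unitTime (2 * N + 2) + unitTime (2 * N + 2)))))) (by omega)
    (lt_two_pow_of_le (by omega)) hM (x := 3) (e := .reg 1)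
    (p := forLoop 2 (.reg 3) (.seq distProg improveProg)) (by simp [Term.nodes])
    (P := fun s => Rows S M idx s ∧ Weights κ s ∧ s.reg 6 = 0)
    (fun k s => s.reg 3 = k ∧ Rows S M idx s ∧ Weights κ s ∧
      Best S idx κ (fun a b => a < b ∧ b < k) s)
    (fun i s h => h.1) (fun i s h => by simpa [Term.val] using h.2.1.active)
    (by
      rintro s ⟨⟨r0, r1, ra, rl⟩, ⟨w1, w2⟩, h6⟩
      exact ⟨by simp, ⟨by simpa using r0, by simpa using r1, ra, rl⟩, ⟨w1, w2⟩,
        Or.inl ⟨by simpa using h6, by omega⟩⟩)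
    (by
      intro k hk
      have hinner := Triple.forLoop (b := 2 * N + 2) (n := k) (N := N)
        (T := unitTime (2 * N + 2) +
          forTime (unitTime (2 * N + 2)) N (unitTime (2 * N + 2)) + (unitTime (2 * N + 2) +
          (unitTime (2 * N + 2) + (unitTime (2 * N + 2) + unitTime (2 * N + 2))))) (by omega)
        (lt_two_pow_of_le (by omega)) (by omega) (x := 2) (e := .reg 3)
        (p := .seq distProg improveProg) (by simp [Term.nodes])
        (P := fun s => s.reg 3 = k ∧ Rows S M idx s ∧ Weights κ s ∧
          Best S idx κ (fun a b => a < b ∧ b < k) s)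
        (fun i s => s.reg 2 = i ∧ s.reg 3 = k ∧ Rows S M idx s ∧ Weights κ s ∧
          Best S idx κ (fun a b => a < b ∧ (b < k ∨ (b = k ∧ a < i))) s)
        (fun i s h => h.1) (fun i s h => by simpa [Term.val] using h.2.1)
        (by
          rintro s ⟨h3, ⟨r0, r1, ra, rl⟩, ⟨w1, w2⟩, hB⟩
          refine ⟨by simp, by simpa using h3, ⟨by simpa using r0, by simpa using r1, ra, rl⟩,
            ⟨w1, w2⟩, hB.congr (by simp) (by simp) (by simp) (by omega)⟩)
        (by
          intro i hi
          refine Triple.seq (Q := fun s => Rows S M idx s ∧ Weights κ s ∧ s.reg 2 = i ∧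
            s.reg 3 = k ∧ Best S idx κ (fun a b => a < b ∧ (b < k ∨ (b = k ∧ a < i))) s ∧
            s.reg 5 = 1 + weightedDist S κ (idx i) (idx k)) ?_ ?_
          · rintro s hs ⟨h2, h3, hR, hW, hB⟩
            obtain ⟨t, s', hex, ht, hs', hR', hW', h2', h3', h6', h7', h8', h5'⟩ :=
              distProg_spec S idx κ hκ (hi.trans hk) hk (s.reg 6) (s.reg 7) (s.reg 8) s hs
                ⟨hR, hW, h2, h3, rfl, rfl, rfl⟩
            exact ⟨t, s', hex, ht, hs', hR', hW', h2', h3',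
              hB.congr h6' h7' h8' (fun _ _ => Iff.rfl), h5'⟩
          · intro s hs hP
            obtain ⟨t, s', hex, ht, hs', ⟨r0, r1, ra, rl⟩, ⟨w1, w2⟩, h2', h3', hB'⟩ :=
              improveProg_spec S idx κ (hi.trans hk) hk
                (fun a b => a < b ∧ (b < k ∨ (b = k ∧ a < i)))
                (fun a b => a < b ∧ (b < k ∨ (b = k ∧ a < i + 1))) (by omega) s hs hP
            exact ⟨t, s', hex, ht, hs', h2', by simp, by simpa using h3',
              ⟨by simpa using r0, by simpa using r1, ra, rl⟩, ⟨w1, w2⟩,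
              hB'.congr (by simp) (by simp) (by simp) (fun _ _ => Iff.rfl)⟩)
      intro s hs hP
      obtain ⟨t, s', hex, ht, hs', h2, h3, ⟨r0, r1, ra, rl⟩, ⟨w1, w2⟩, hB⟩ := hinner s hs hP
      exact ⟨t, s', hex, ht, hs', h3, by simp, ⟨by simpa using r0, by simpa using r1, ra, rl⟩,
        ⟨w1, w2⟩, hB.congr (by simp) (by simp) (by simp) (by omega)⟩)
  intro s hs hP
  obtain ⟨t, s', hex, ht, hs', _, hR, hW, hB⟩ := houter s hs hP
  refine ⟨t, s', hex, ht, hs', hR, hW, _, _, rfl, rfl, ?_⟩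
  rcases hB with ⟨_, hno⟩ | ⟨⟨h1, h2⟩, _, hmin⟩
  -- At least two rows are active, so the pair (0, 1) has been examined.
  · exact absurd ⟨by omega, by omega⟩ (hno 0 1)
  · exact ⟨h1, h2, fun i' k' h h' => hmin i' k' ⟨h, h'⟩⟩

theorem updateProg_spec {N : ℕ} (S : Matrix (Fin N) (Fin N) ℤˣ) {M : ℕ} (idx : ℕ → Fin N)
    (κ κ' : Fin N → ℕ) {i k : ℕ} (hi : i < M) (hk : k < M)
    (hκ' : ∀ j, κ' j = κ j + if S (idx i) j ≠ S (idx k) j then 1 else 0) (hκ : ∀ j, κ' j ≤ N) :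
    Triple (2 * N + 2) (forTime (unitTime (2 * N + 2)) N (unitTime (2 * N + 2) +
        unitTime (2 * N + 2)))
      (fun s => Rows S M idx s ∧ Weights κ s ∧ s.reg 7 = i ∧ s.reg 8 = k) updateProg
      (fun s => Rows S M idx s ∧ Weights κ' s ∧ s.reg 8 = k) := by
  have h := Triple.forLoop (b := 2 * N + 2) (n := N) (N := N)
    (T := unitTime (2 * N + 2) + unitTime (2 * N + 2)) (by omega)
    (lt_two_pow_of_le (by omega)) le_rfl (x := 4) (e := .reg 0)
    (p := .seq
      (.put 1 (.reg 4)
        (.add (.get 1 (.reg 4)) (.mul (.get 1 (.reg 4)) (diffTerm (.reg 7) (.reg 8)))))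
      (.put 2 (.reg 4) (.add (.get 2 (.reg 4)) (diffTerm (.reg 7) (.reg 8)))))
    (by simp [Term.nodes])
    (P := fun s => Rows S M idx s ∧ Weights κ s ∧ s.reg 7 = i ∧ s.reg 8 = k)
    (fun j s => s.reg 4 = j ∧ Rows S M idx s ∧ s.reg 7 = i ∧ s.reg 8 = k ∧
      (∀ j' : Fin N, s.arr 1 j' = if (j' : ℕ) < j then 2 ^ κ' j' else 2 ^ κ j') ∧
      ∀ j' : Fin N, s.arr 2 j' = if (j' : ℕ) < j then κ' j' else κ j')
    (fun i s h => h.1) (fun i s h => by simpa [Term.val] using h.2.1.size)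
    (by
      rintro s ⟨⟨r0, r1, ra, rl⟩, ⟨w1, w2⟩, h7, h8⟩
      exact ⟨by simp, ⟨by simpa using r0, by simpa using r1, ra, rl⟩, by simpa using h7,
        by simpa using h8, by simpa using w1, by simpa using w2⟩)
    (by
      intro j hj
      refine Triple.seq (Q := fun s => s.reg 4 = j ∧ Rows S M idx s ∧ s.reg 7 = i ∧ s.reg 8 = k ∧
          (∀ j' : Fin N, s.arr 1 j' = if (j' : ℕ) < j + 1 then 2 ^ κ' j' else 2 ^ κ j') ∧
          ∀ j' : Fin N, s.arr 2 j' = if (j' : ℕ) < j then κ' j' else κ j')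
        (Triple.put (by omega) (by simp [Term.nodes])
          (by simp [Term.nodes, diffTerm, entryTerm]) ?_)
        (Triple.put (by omega) (by simp [Term.nodes])
          (by simp [Term.nodes, diffTerm, entryTerm]) ?_)
      · rintro s - ⟨h4, hR, h7, h8, w1, w2⟩
        have hdiff := hR.diffTerm_val (r := .reg 7) (r' := .reg 8) h7 h8 hi hk ⟨j, hj⟩ h4
        have hval : (Term.add (.get 1 (.reg 4))
            (.mul (.get 1 (.reg 4)) (diffTerm (.reg 7) (.reg 8)))).val s = 2 ^ κ' ⟨j, hj⟩ := by
          have hw := w1 ⟨j, hj⟩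
          simp only [lt_irrefl, if_false] at hw
          simp only [Term.val, hdiff, h4, hw, hκ']
          split_ifs <;> ring
        rw [hval]
        obtain ⟨r0, r1, ra, rl⟩ := hR
        refine ⟨Nat.pow_lt_pow_right (by norm_num) (by have := hκ ⟨j, hj⟩; omega), h4,
          ⟨r0, r1, by simpa using ra, by simpa using rl⟩, h7, h8, ?_, by simpa using w2⟩
        intro j'
        simp only [Term.val, h4, Function.update_self]
        by_cases hjj : (j' : ℕ) = j
        · have : j' = ⟨j, hj⟩ := Fin.ext hjj
          subst this
          simp
        · rw [Function.update_of_ne hjj, w1]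
          exact if_congr (by omega) rfl rfl
      · rintro s - ⟨h4, hR, h7, h8, w1, w2⟩
        have hdiff := hR.diffTerm_val (r := .reg 7) (r' := .reg 8) h7 h8 hi hk ⟨j, hj⟩ h4
        have hval : (Term.add (.get 2 (.reg 4)) (diffTerm (.reg 7) (.reg 8))).val s
            = κ' ⟨j, hj⟩ := by
          have hw := w2 ⟨j, hj⟩
          simp only [lt_irrefl, if_false] at hw
          simp only [Term.val, hdiff, h4, hw, hκ']
        rw [hval]
        obtain ⟨r0, r1, ra, rl⟩ := hR
        refine ⟨lt_two_pow_of_le (by have := hκ ⟨j, hj⟩; omega), h4, by simp,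
          ⟨by simpa using r0, by simpa using r1, by simpa using ra, by simpa using rl⟩,
          by simpa using h7, by simpa using h8, by simpa using w1, ?_⟩
        intro j'
        simp only [Term.val, h4, Function.update_self]
        by_cases hjj : (j' : ℕ) = j
        · have : j' = ⟨j, hj⟩ := Fin.ext hjj
          subst this
          simp
        · rw [Function.update_of_ne hjj, w2]
          exact if_congr (by omega) rfl rfl)
  intro s hs hP
  obtain ⟨t, s', hex, ht, hs', _, hR, _, h8, w1, w2⟩ := h s hs hP
  exact ⟨t, s', hex, ht, hs', hR, ⟨by simpa using w1, by simpa using w2⟩, h8⟩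

theorem deleteProg_spec {N : ℕ} (S : Matrix (Fin N) (Fin N) ℤˣ) {M : ℕ} (hM : M + 1 ≤ N)
    (idx : ℕ → Fin N) (κ : Fin N → ℕ) {k : ℕ} :
    Triple (2 * N + 2) (unitTime (2 * N + 2) + unitTime (2 * N + 2))
      (fun s => Rows S (M + 1) idx s ∧ Weights κ s ∧ s.reg 8 = k) deleteProg
      (fun s => Rows S M (Function.update idx k (idx M)) s ∧ Weights κ s) := by
  refine Triple.seq (Q := fun s => s.reg 0 = N ∧ s.reg 1 = M ∧ s.arr 0 = (input S).arr 0 ∧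
      (∀ p < M + 1, s.arr 3 p = idx p) ∧ Weights κ s ∧ s.reg 8 = k)
    (Triple.assign (by omega) (by simp [Term.nodes]) ?_)
    (Triple.put (by omega) (by simp [Term.nodes]) (by simp [Term.nodes]) ?_)
  · rintro s - ⟨⟨r0, r1, ra, rl⟩, ⟨w1, w2⟩, h8⟩
    exact ⟨by simp only [Term.val, r1]; exact lt_two_pow_of_le (by omega), by simpa using r0,
      by simp [Term.val, r1], ra, rl, ⟨w1, w2⟩, by simpa using h8⟩
  · rintro s hb ⟨r0, r1, ra, rl, ⟨w1, w2⟩, h8⟩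
    refine ⟨by simpa [Term.val] using hb.2 3 _, ⟨r0, r1, by simpa using ra, ?_⟩,
      ⟨by simpa using w1, by simpa using w2⟩⟩
    intro p hp
    simp only [Term.val, h8, r1, Function.update_self, rl M (Nat.lt_succ_self M)]
    by_cases h : p = k
    · simp [h]
    · rw [Function.update_of_ne h, Function.update_of_ne h]
      exact rl p (by omega)

theorem outputProg_spec {N : ℕ} (κ : Fin N → ℕ) (hκ : ∀ j, κ j ≤ N) :
    Triple (2 * N + 2) (unitTime (2 * N + 2) +
        (forTime (unitTime (2 * N + 2)) N (unitTime (2 * N + 2)) + unitTime (2 * N + 2)))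
      (fun s => s.reg 0 = N ∧ Weights κ s) outputProg
      (fun s => s.reg 0 = 2 * Finset.univ.sup κ + 1) := by
  set g : ℕ → ℕ := fun j => if h : j < N then κ ⟨j, h⟩ else 0 with hg
  have hgN : ∀ j, g j ≤ N := by
    intro j
    simp only [hg]
    split_ifs
    exacts [hκ _, Nat.zero_le _]
  have hsup : (Finset.range N).sup g = Finset.univ.sup κ := by
    apply le_antisymm
    · refine Finset.sup_le fun j hj => ?_
      have hj' := Finset.mem_range.1 hj
      simp only [hg, hj', dif_pos]
      exact Finset.le_sup (Finset.mem_univ _)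
    · refine Finset.sup_le fun j _ => ?_
      have := Finset.le_sup (f := g) (Finset.mem_range.2 j.2)
      simpa [hg] using this
  refine Triple.seq (Q := fun s => s.reg 0 = N ∧ Weights κ s ∧ s.reg 5 = 0)
    (Triple.assign (by omega) (by simp [Term.nodes]) ?_)
    (Triple.seq (Q := fun s => s.reg 5 = Finset.univ.sup κ) ?_
    (Triple.assign (by omega) (by simp [Term.nodes]) ?_))
  · rintro s - ⟨r0, ⟨w1, w2⟩⟩
    exact ⟨by simp [Term.val], by simpa using r0, ⟨w1, w2⟩, by simp [Term.val]⟩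
  · have h := Triple.forLoop (b := 2 * N + 2) (n := N) (N := N)
      (T := unitTime (2 * N + 2)) (by omega)
      (lt_two_pow_of_le (by omega)) le_rfl (x := 4) (e := .reg 0)
      (p := .assign 5 (.add (.reg 5) (.sub (.get 2 (.reg 4)) (.reg 5))))
      (by simp [Term.nodes])
      (P := fun s => s.reg 0 = N ∧ Weights κ s ∧ s.reg 5 = 0)
      (fun j s => s.reg 4 = j ∧ s.reg 0 = N ∧ Weights κ s ∧ s.reg 5 = (Finset.range j).sup g)
      (fun i s h => h.1) (fun i s h => by simpa [Term.val] using h.2.1)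
      (by
        rintro s ⟨r0, ⟨w1, w2⟩, h5⟩
        exact ⟨by simp, by simpa using r0, ⟨w1, w2⟩, by simpa using h5⟩)
      (by
        intro j hj
        refine Triple.assign (by omega) (by simp [Term.nodes]) ?_
        rintro s - ⟨h4, r0, ⟨w1, w2⟩, h5⟩
        -- With truncated subtraction, x + (y - x) is the maximum of x and y.
        have hval : (Term.add (.reg 5) (.sub (.get 2 (.reg 4)) (.reg 5))).val s =
            (Finset.range (j + 1)).sup g := by
          have hw := w2 ⟨j, hj⟩
          simp only at hw
          have hgj : g j = κ ⟨j, hj⟩ := by simp [hg, hj]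
          rw [Finset.range_add_one, Finset.sup_insert, hgj]
          simp only [Term.val, h4, h5, hw]
          rw [max_def]
          split_ifs <;> omega
        have hle : (Finset.range (j + 1)).sup g ≤ N := Finset.sup_le fun i _ => hgN i
        rw [hval]
        exact ⟨lt_two_pow_of_le (by omega), by simpa using h4, by simp, by simpa using r0,
          ⟨w1, w2⟩, by simp⟩)
    intro s hs hP
    obtain ⟨t, s', hex, ht, hs', _, _, _, h5⟩ := h s hs hP
    exact ⟨t, s', hex, ht, hs', h5.trans hsup⟩
  · rintro s - h5
    have hle : Finset.univ.sup κ ≤ N := Finset.sup_le fun i _ => hκ i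
    simp only [Term.val, h5, Function.update_self, and_true]
    exact lt_two_pow_of_le (by omega)

/-- The running time of `signRankProg` on `N × N` matrices, where `u` bounds the time of an
assignment or test. -/
def totalTime {R : Type*} [CommSemiring R] (u N : R) : R :=
  forTime u N (u + u) + u +
    (u + N * (u + forTime u N (forTime u N (u + forTime u N u + (u + (u + (u + u))))) +
      (forTime u N (u + u) + (u + u)) + u) +
    (u + (forTime u N u + u)))

theorem input_bdd {N : ℕ} (S : Matrix (Fin N) (Fin N) ℤˣ) : (input S).Bdd (2 * N + 2) := by
  constructor
  · intro x
    simp only [input]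
    apply lt_two_pow_of_le
    split_ifs <;> omega
  · intro a k
    simp only [input]
    apply lt_two_pow_of_le
    split_ifs <;> omega

theorem signRankProg_spec {N : ℕ} (hN : 1 ≤ N) (S : Matrix (Fin N) (Fin N) ℤˣ) :
    ∃ (t : ℕ) (idx : ℕ → Fin N) (κ : Fin N → ℕ), GreedyState S 1 idx κ ∧
      t ≤ totalTime (unitTime (2 * N + 2)) N ∧
      Outputs signRankProg S t (2 * Finset.univ.sup κ + 1) := by
  set u : ℕ := unitTime (2 * N + 2) with hu
  -- The reduction modulo N only makes the list total; positions from N on are never used.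
  let idx₀ : ℕ → Fin N := fun p => ⟨p % N, Nat.mod_lt _ hN⟩
  have hidx₀ : ∀ p < N, (idx₀ p : ℕ) = p := fun p hp => Nat.mod_eq_of_lt hp
  obtain ⟨t₁, s₁, hex₁, ht₁, hs₁, hR₁, hW₁⟩ :=
    initProg_spec S idx₀ hidx₀ (input S) (input_bdd S) rfl
  have hloop := Triple.loop (b := 2 * N + 2)
    (T := u + forTime u N (forTime u N (u + forTime u N u + (u + (u + (u + u))))) +
      (forTime u N (u + u) + (u + u))) (by omega)
    (e := .sub (.reg 1) (.lit 1)) (p := .seq searchProg (.seq updateProg deleteProg))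
    (by simp [Term.nodes])
    -- The index m counts the tree edges still missing, so m + 1 rows are active.
    (fun m s => m + 1 ≤ N ∧ ∃ idx κ, GreedyState S (m + 1) idx κ ∧ Rows S (m + 1) idx s ∧
      Weights κ s)
    (by
      rintro s ⟨_, idx, κ, _, hR, _⟩
      simp [Term.val, hR.active])
    (by
      rintro m s ⟨_, idx, κ, _, hR, _⟩
      simp [Term.val, hR.active]) (N - 1)
    (by
      rintro m hm s hs ⟨hmN, idx, κ, hG, hR, hW⟩
      obtain ⟨t, s', hex, ht, hs', hR', hW', i, k, h7, h8, hik, hk, hmin⟩ :=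
        searchProg_spec S (M := m + 2) hmN (by omega) idx κ
          (fun j => by have := hG.count j; omega) hu rfl s hs ⟨hR, hW⟩
      have hG' := hG.step hmN hik hk hmin
      obtain ⟨t', s'', hex', ht', hs'', hR'', hW'', h8'⟩ :=
        updateProg_spec S idx κ _ (hik.trans hk) hk (fun j => rfl)
          (fun j => by have := hG'.count j; omega) s' hs' ⟨hR', hW', h7, h8⟩
      obtain ⟨t₃, s₃, hex₃, ht₃, hs₃, hR₃, hW₃⟩ :=
        deleteProg_spec S hmN idx _ s'' hs'' ⟨hR'', hW'', h8'⟩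
      refine ⟨_, _, .seq hex (.seq hex' hex₃), ?_, hs₃, by omega, _, _, hG', hR₃, hW₃⟩
      rw [← hu] at ht' ht₃
      omega)
  have hN1 : N - 1 + 1 = N := by omega
  obtain ⟨t₂, s₂, hex₂, ht₂, hs₂, _, idx, κ, hG, hR₂, hW₂⟩ := hloop s₁ hs₁
    ⟨by omega, idx₀, fun _ => 0, by rw [hN1]; exact GreedyState.initial S idx₀ hidx₀,
      by rw [hN1]; exact hR₁, hW₁⟩
  obtain ⟨t₃, s₃, hex₃, ht₃, hs₃, hout⟩ :=
    outputProg_spec κ (fun j => by have := hG.count j; omega) s₂ hs₂ ⟨hR₂.size, hW₂⟩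
  refine ⟨_, idx, κ, hG, ?_, s₃, .seq hex₁ (.seq hex₂ hex₃), hout⟩
  rw [← hu] at ht₁ ht₂ ht₃
  have hle : t₂ ≤ u + N * (u + forTime u N (forTime u N (u + forTime u N u + (u + (u + (u + u))))) +
      (forTime u N (u + u) + (u + u)) + u) :=
    ht₂.trans (Nat.add_le_add_left (Nat.mul_le_mul_right _ (Nat.sub_le N 1)) u)
  unfold totalTime
  exact Nat.add_le_add ht₁ (Nat.add_le_add hle ht₃)

end RAM

/-! ### The approximation theorem -/

theorem theorem8 :
    ∃ (c : ℝ) (p : RAM.Prog) (P : Polynomial ℕ), 0 < c ∧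
      ∀ (N : ℕ), 2 ≤ N → ∀ S : Matrix (Fin N) (Fin N) ℤˣ,
        ∃ t A : ℕ, RAM.Outputs p S t A ∧ t ≤ P.eval N ∧
          signRank S ≤ A ∧ (A : ℝ) ≤ c * ((N : ℝ) / Real.log N) * (signRank S : ℝ) := by
  -- The time formulas make sense in any commutative semiring: read in ℕ[X] they are the required
  -- polynomial, and evaluation at N returns the bound proved in ℕ.
  refine ⟨200, RAM.signRankProg,
    RAM.totalTime (RAM.unitTime (2 * Polynomial.X + 2)) Polynomial.X, by norm_num, ?_⟩
  intro N hN S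
  obtain ⟨t, idx, κ, hG, ht, hout⟩ := RAM.signRankProg_spec (by omega) S
  refine ⟨t, _, hout, ?_, hG.signRank_le fun j => Finset.le_sup (Finset.mem_univ j), ?_⟩
  · simpa [RAM.totalTime, RAM.unitTime, RAM.forTime] using ht
  · obtain ⟨j, _, hj⟩ := Finset.exists_mem_eq_sup Finset.univ ⟨idx 0, Finset.mem_univ _⟩ κ
    rw [hj]
    exact hG.le_signRank hN j
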